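/- **Setting.** Let $d\ge 2$, $n\ge 3$, $r\in\mathbb{R}^n$ and $\varrho\in\mathbb{R}^n$ with all $r_i>0$ and $\varrho_i>0$, and assume $r_j<\frac12\sum_{i=1}^n r_i$ for every $j$. Let $\mathbb{B}=\{w\in\mathbb{R}^d:|w|<1\}$ and $\mathbb{S}=\{x\in\mathbb{R}^d:|x|=1\}$. Let $\mathrm{Arm}^\times\subset(\mathbb{R}^d)^n$ be the set of $n$-tuples $x=(x_1,\dots,x_n)$ of pairwise distinct points of $\mathbb{S}$, and let $\mathrm{Pol}^\times=\{y\in\mathrm{Arm}^\times:\sum_i r_iy_i=0\}$. Equip $(\mathbb{R}^d)^n$ with the inner product $\langle u,v\rangle_\varrho=\sum_i\varrho_i^2\langle u_i,v_i\rangle$, $\mathbb{R}^d$ with the standard one, and $\mathbb{R}^d\times(\mathbb{R}^d)^n$ with their product; $\mathrm{Arm}^\times$ and $\mathbb{B}\times\mathrm{Pol}^\times$ carry the restrictions of these metrics. Put $$\sigma(w,z)=\frac{(1-|w|^2)\,z-(1+|z|^2-2\langle w,z\rangle)\,w}{1-2\langle w,z\rangle+|w|^2|z|^2},$$ and let the conformal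 opening map be $\mathrm{op}(w,y)=(\sigma(-w,y_1),\dots,\sigma(-w,y_n))$. Its Jacobian is $J\mathrm{op}(w,y)=\sqrt{\det(D\mathrm{op}(w,y)^*\,D\mathrm{op}(w,y))}$, where $D\mathrm{op}(w,y)$ is the differential on $T_{(w,y)}(\mathbb{B}\times\mathrm{Pol}^\times)$ and the adjoint is taken with respect to the metrics above. Regard $\mathbb{B}$ as the Poincaré ball model of hyperbolic space. For $w\in\mathbb{B}$ and $x\in\mathbb{S}$, the director $V_x(w)$ is the (hyperbolic) unit tangent vector at $w$ of the geodesic ray from $w$ to the ideal point $x$. A point $w\in\mathbb{B}$ is a conformal barycenter of $x\in\mathrm{Arm}^\times$ if $\sum_i r_iV_{x_i}(w)=0$. **Theorem 3.1.** 1. For all $(w,y)\in\mathbb{B}\times\mathrm{Pol}^\times$, $$J\mathrm{op}(w,y)=\Big(\frac{2}{1-|w|^2}\Big)^{d}\,\frac{\det\big(\sum_{i=1}^n r_i\,(I_d-y_iy_i^{T})\big)}{\sqrt{\det\big(\sum_{i=1}^n (r_i^2/\varrho_i^2)\,(I_d-y_iy_i^{T})\big)}}\,\Big(\prod_{i=1}^n\frac{1-|w|^2}{|w+y_i|^2}\Big)^{d-1}\neq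 0.$$ 2. $\mathbb{B}\times\mathrm{Pol}^\times$ and $\mathrm{Arm}^\times$ are smooth embedded submanifolds of $\mathbb{R}^d\times(\mathbb{R}^d)^n$ and $(\mathbb{R}^d)^n$, both of dimension $n(d-1)$. Every $x\in\mathrm{Arm}^\times$ has exactly one conformal barycenter $w_*(x)$. The map $\mathrm{op}$ is a diffeomorphism of $\mathbb{B}\times\mathrm{Pol}^\times$ onto $\mathrm{Arm}^\times$, and its inverse is the conformal closure map $\mathrm{cl}(x)=\big(w_*(x),(\sigma(w_*(x),x_1),\dots,\sigma(w_*(x),x_n))\big)$, which is therefore a diffeomorphism of $\mathrm{Arm}^\times$ onto $\mathbb{B}\times\mathrm{Pol}^\times$. 3. For fixed $d$, $J\mathrm{op}(w,y)$ can be computed in $O(n)$ time and memory: for every $d\ge2$ there are a single program of a real random access machine (exact real arithmetic $+,-,\times,/,\sqrt{\ }$ and comparisons, rational constants, indirectly addressed real memory and bounded loops, each elementary operation costing one step) and a constant $C$ such that for all $n\ge3$ and all $r,\varrho,w,y$ as above, the program, started with $(n,r,\varrho,w,y)$ in its memory, outputs $J\mathrm{op}(w,y)$ after at most $Cn$ steps,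 accessing only the first $Cn$ cells of its memory. -/

import Mathlib

open scoped ContDiff

noncomputable section

namespace ConformalPolygon

/-! ### Smooth maps, submanifolds, tangent spaces and Jacobians in normed spaces -/

section Smooth

variable {E F : Type*} [NormedAddCommGroup E] [NormedSpace ℝ E]
  [NormedAddCommGroup F] [NormedSpace ℝ F]

/-- Smoothness of a map on an arbitrary subset `S` of a normed space: near every point of `S`
the map is the restriction of a smooth map defined on an open set of the ambient space. -/
def SmoothOnSubset (f : E → F) (S : Set E) : Prop :=
  ∀ p ∈ S, ∃ U : Set E, IsOpen U ∧ p ∈ U ∧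
    ∃ g : E → F, ContDiffOn ℝ ∞ g U ∧ Set.EqOn g f (S ∩ U)

/-- `f` restricts to a diffeomorphism of `S` onto `T`, and `g` restricts to its inverse. -/
structure IsDiffeomorphismWithInverse (f : E → F) (g : F → E) (S : Set E) (T : Set F) : Prop where
  mapsTo : Set.MapsTo f S T
  mapsTo_inv : Set.MapsTo g T S
  leftInv : ∀ p ∈ S, g (f p) = p
  rightInv : ∀ q ∈ T, f (g q) = q
  smooth : SmoothOnSubset f S
  smooth_inv : SmoothOnSubset g T

/-- `M` is a smooth embedded submanifold of dimension `k`: locally it is the zero set of a smooth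
submersion onto `ℝᵐ`, where `k + m` is the dimension of the ambient space. -/
def IsSmoothSubmanifold (M : Set E) (k : ℕ) : Prop :=
  ∃ m : ℕ, k + m = Module.finrank ℝ E ∧ ∀ p ∈ M, ∃ U : Set E, IsOpen U ∧ p ∈ U ∧
    ∃ Φ : E → EuclideanSpace ℝ (Fin m), ContDiffOn ℝ ∞ Φ U ∧
      M ∩ U = {q ∈ U | Φ q = 0} ∧ ∀ q ∈ M ∩ U, Function.Surjective (fderiv ℝ Φ q)

/-- The tangent space of `M` at `p`, spanned by the velocities of smooth curves in `M`
through `p`. -/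
def tangentSpaceAt (M : Set E) (p : E) : Submodule ℝ E :=
  Submodule.span ℝ {v | ∃ γ : ℝ → E, ∃ ε : ℝ, 0 < ε ∧ ContDiffOn ℝ ∞ γ (Set.Ioo (-ε) ε) ∧
    (∀ t ∈ Set.Ioo (-ε) ε, γ t ∈ M) ∧ γ 0 = p ∧ deriv γ 0 = v}

/-- The differential at `p` of `f` restricted to `M`, as a linear map on the tangent space. -/
def differentialAlong (f : E → F) (M : Set E) (p : E) : tangentSpaceAt M p →ₗ[ℝ] F :=
  (fderivWithin ℝ f M p : E →ₗ[ℝ] F) ∘ₗ (tangentSpaceAt M p).subtype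

end Smooth

section Adjoint

variable {T W : Type*} [AddCommGroup T] [Module ℝ T] [AddCommGroup W] [Module ℝ W]

/-- Restrictions of positive definite forms to subspaces are nondegenerate. -/
theorem restrict_nondegenerate (g : LinearMap.BilinForm ℝ T) (hg : ∀ v, v ≠ 0 → 0 < g v v)
    (V : Submodule ℝ T) : (g.restrict V).Nondegenerate := by
  constructor
  · intro x hx
    by_contra hne
    have h1 : (x : T) ≠ 0 := fun h => hne (Subtype.ext h)
    exact (hg x h1).ne' (hx x)
  · intro x hx
    by_contra hne
    have h1 : (x : T) ≠ 0 := fun h => hne (Subtype.ext h)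
    exact (hg x h1).ne' (hx x)

/-- The adjoint of `L : (T, g) → (W, h)`, characterised by `g (L* u) v = h u (L v)`. -/
def metricAdjoint [FiniteDimensional ℝ T] (g : LinearMap.BilinForm ℝ T) (hg : g.Nondegenerate)
    (h : LinearMap.BilinForm ℝ W) (L : T →ₗ[ℝ] W) : W →ₗ[ℝ] T :=
  (LinearMap.BilinForm.toDual g hg).symm.toLinearMap ∘ₗ L.dualMap ∘ₗ h

theorem metricAdjoint_spec [FiniteDimensional ℝ T] (g : LinearMap.BilinForm ℝ T)
    (hg : g.Nondegenerate) (h : LinearMap.BilinForm ℝ W) (L : T →ₗ[ℝ] W) (u : W) (v : T) :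
    g (metricAdjoint g hg h L u) v = h u (L v) := by
  simp [metricAdjoint]

end Adjoint

/-- The Jacobian determinant `√(det (Df* Df))` at `p` of `f` restricted to the submanifold `M`.
Domain and codomain carry the restrictions of the inner products `g` and `h` of the ambient spaces,
so it does not matter whether `Df` is regarded as a map into the ambient space or into the tangent
space of a submanifold that contains the image of `M`. -/
def jacobianAlong {E F : Type*} [NormedAddCommGroup E] [NormedSpace ℝ E] [FiniteDimensional ℝ E]
    [NormedAddCommGroup F] [NormedSpace ℝ F]
    (g : LinearMap.BilinForm ℝ E) (hg : ∀ v, v ≠ 0 → 0 < g v v) (h : LinearMap.BilinForm ℝ F)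
    (f : E → F) (M : Set E) (p : E) : ℝ :=
  let D := differentialAlong f M p
  let Dadj := metricAdjoint (g.restrict (tangentSpaceAt M p))
    (restrict_nondegenerate g hg (tangentSpaceAt M p)) h D
  Real.sqrt (LinearMap.det (Dadj ∘ₗ D))

/-! ### Polygon spaces and their metrics -/

variable {d n : ℕ}

/-- `ℝᵈ` with its Euclidean norm. -/
abbrev Vec (d : ℕ) : Type := EuclideanSpace ℝ (Fin d)

/-- The open unit ball of `ℝᵈ`. -/
def unitBall (d : ℕ) : Set (Vec d) := Metric.ball 0 1

/-- `n`-tuples of unit vectors: the directions of the edges of an open polygon. -/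
def Arm (d n : ℕ) : Set (Fin n → Vec d) := {x | ∀ i, ‖x i‖ = 1}

/-- Directions of closed polygons with edge lengths `r`. -/
def Pol (d : ℕ) {n : ℕ} (r : Fin n → ℝ) : Set (Fin n → Vec d) :=
  {y | y ∈ Arm d n ∧ ∑ i, r i • y i = 0}

/-- Open polygons with pairwise distinct edge directions. -/
def ArmX (d n : ℕ) : Set (Fin n → Vec d) :=
  {x | x ∈ Arm d n ∧ ∀ i j, i ≠ j → x i ≠ x j}

/-- Closed polygons with pairwise distinct edge directions. -/
def PolX (d : ℕ) {n : ℕ} (r : Fin n → ℝ) : Set (Fin n → Vec d) := Pol d r ∩ ArmX d n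

/-- The inner product `∑ ϱᵢ² ⟨uᵢ, vᵢ⟩` on `(ℝᵈ)ⁿ`. -/
def armMetric (d : ℕ) {n : ℕ} (ϱ : Fin n → ℝ) : LinearMap.BilinForm ℝ (Fin n → Vec d) :=
  LinearMap.mk₂ ℝ (fun u v => ∑ i, ϱ i ^ 2 * inner ℝ (u i) (v i))
    (fun u u' v => by simp [inner_add_left, mul_add, Finset.sum_add_distrib])
    (fun c u v => by
      simp only [Pi.smul_apply, real_inner_smul_left, smul_eq_mul, Finset.mul_sum]
      exact Finset.sum_congr rfl fun i _ => by ring)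
    (fun u v v' => by simp [inner_add_right, mul_add, Finset.sum_add_distrib])
    (fun c u v => by
      simp only [Pi.smul_apply, real_inner_smul_right, smul_eq_mul, Finset.mul_sum]
      exact Finset.sum_congr rfl fun i _ => by ring)

/-- The product of the Euclidean inner product on `ℝᵈ` and of `armMetric` on `(ℝᵈ)ⁿ`. -/
def ballPolMetric (d : ℕ) {n : ℕ} (ϱ : Fin n → ℝ) :
    LinearMap.BilinForm ℝ (Vec d × (Fin n → Vec d)) :=
  LinearMap.mk₂ ℝ (fun u v => inner ℝ u.1 v.1 + armMetric d ϱ u.2 v.2)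
    (fun u u' v => by
      simp only [Prod.fst_add, Prod.snd_add, inner_add_left, map_add, LinearMap.add_apply]
      ring)
    (fun c u v => by
      simp only [Prod.smul_fst, Prod.smul_snd, real_inner_smul_left, map_smul,
        LinearMap.smul_apply, smul_eq_mul]
      ring)
    (fun u v v' => by
      simp only [Prod.fst_add, Prod.snd_add, inner_add_right, map_add]
      ring)
    (fun c u v => by
      simp only [Prod.smul_fst, Prod.smul_snd, real_inner_smul_right, map_smul, smul_eq_mul]
      ring)

theorem ballPolMetric_pos (d : ℕ) {n : ℕ} (ϱ : Fin n → ℝ) (hϱ : ∀ i, 0 < ϱ i)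
    (v : Vec d × (Fin n → Vec d)) (hv : v ≠ 0) : 0 < ballPolMetric d ϱ v v := by
  have key : ballPolMetric d ϱ v v = ‖v.1‖ ^ 2 + ∑ i, ϱ i ^ 2 * ‖v.2 i‖ ^ 2 := by
    simp [ballPolMetric, armMetric]
  have hs : 0 ≤ ∑ i, ϱ i ^ 2 * ‖v.2 i‖ ^ 2 := Finset.sum_nonneg fun i _ => by positivity
  rw [key]
  by_contra hle
  have h1 : ‖v.1‖ ^ 2 = 0 := by nlinarith [sq_nonneg ‖v.1‖]
  have h2 : ∑ i, ϱ i ^ 2 * ‖v.2 i‖ ^ 2 = 0 := by nlinarith [sq_nonneg ‖v.1‖]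
  rw [Finset.sum_eq_zero_iff_of_nonneg (fun i _ => by positivity)] at h2
  apply hv
  refine Prod.ext (by simpa using h1) (funext fun i => ?_)
  have h3 := h2 i (Finset.mem_univ i)
  have h4 := (hϱ i).ne'
  simpa [h4] using h3

/-! ### The shift map, the opening map, the conformal barycenter and the closure map -/

/-- The shift map `σ(w, z)`: the hyperbolic translation that moves `w` to `0`. -/
def shift (w z : Vec d) : Vec d :=
  (1 - 2 * inner ℝ w z + ‖w‖ ^ 2 * ‖z‖ ^ 2)⁻¹ •
    ((1 - ‖w‖ ^ 2) • z - (1 + ‖z‖ ^ 2 - 2 * inner ℝ w z) • w)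

/-- The conformal opening map `(w, y) ↦ (σ(-w, yᵢ))ᵢ`. -/
def opening (p : Vec d × (Fin n → Vec d)) : Fin n → Vec d := fun i => shift (-p.1) (p.2 i)

/-- The Jacobian determinant of the opening map on `𝔹 × Pol^×`. -/
def Jop (r ϱ : Fin n → ℝ) (hϱ : ∀ i, 0 < ϱ i) (w : Vec d) (y : Fin n → Vec d) : ℝ :=
  jacobianAlong (ballPolMetric d ϱ) (ballPolMetric_pos d ϱ hϱ) (armMetric d ϱ)
    opening (unitBall d ×ˢ PolX d r) (w, y)

/-- The hyperbolic distance in the Poincaré ball model (curvature `-1`). -/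
def hypDist (u v : Vec d) : ℝ :=
  Real.arcosh (1 + 2 * ‖u - v‖ ^ 2 / ((1 - ‖u‖ ^ 2) * (1 - ‖v‖ ^ 2)))

/-- `γ`, restricted to `[0, ∞)`, is the unit speed hyperbolic geodesic ray from the point `w` of
the ball to the point `x` of the sphere at infinity. -/
structure IsGeodesicRay (w x : Vec d) (γ : ℝ → Vec d) : Prop where
  mem_ball : ∀ t, 0 ≤ t → γ t ∈ unitBall d
  isometry : ∀ s t, 0 ≤ s → 0 ≤ t → hypDist (γ s) (γ t) = |s - t|
  start : γ 0 = w
  limit : Filter.Tendsto γ Filter.atTop (nhds x)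

/-- `v` is the director at `w` towards `x`: the (hyperbolic) unit tangent vector at `w` to the
geodesic ray joining `w` to `x`. -/
def IsDirector (w x v : Vec d) : Prop :=
  ∃ γ : ℝ → Vec d, IsGeodesicRay w x γ ∧ HasDerivWithinAt γ v (Set.Ici 0) 0

/-- `w` is a conformal barycenter of `x` with weights `r`. -/
def IsConformalBarycenter (r : Fin n → ℝ) (x : Fin n → Vec d) (w : Vec d) : Prop :=
  w ∈ unitBall d ∧ ∃ V : Fin n → Vec d, (∀ i, IsDirector w (x i) (V i)) ∧ ∑ i, r i • V i = 0

open Classical in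
/-- The conformal barycenter `w_*(x)` (the value `0` is used if there is none). -/
def conformalBarycenter (r : Fin n → ℝ) (x : Fin n → Vec d) : Vec d :=
  if h : ∃ w, IsConformalBarycenter r x w then h.choose else 0

/-- The conformal closure map `x ↦ (w_*(x), (σ(w_*(x), xᵢ))ᵢ)`. -/
def closureMap (r : Fin n → ℝ) (x : Fin n → Vec d) : Vec d × (Fin n → Vec d) :=
  (conformalBarycenter r x, fun i => shift (conformalBarycenter r x) (x i))

/-- The matrix `∑ cᵢ (I - yᵢ yᵢᵀ)`. -/
def projSum (c : Fin n → ℝ) (y : Fin n → Vec d) : Matrix (Fin d) (Fin d) ℝ :=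
  ∑ i, c i • (1 - Matrix.of fun a b => y i a * y i b)

/-! ### A real random access machine with step and memory counts -/

namespace RealRAM

/-- Programs of a real random access machine.  The machine has real registers `x₀, x₁, …`, index
registers `p₀, p₁, …` with values in `ℕ`, and an array of real memory cells `m[0], m[1], …` that is
addressed through the index registers.  Any given program mentions only finitely many registers. -/
inductive Prog : Type
  /-- do nothing -/
  | skip : Prog
  /-- `x_a := q` -/
  | const (a : ℕ) (q : ℚ) : Prog
  /-- `x_a := x_b + x_c` -/
  | add (a b c : ℕ) : Prog
  /-- `x_a := x_b - x_c` -/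
  | sub (a b c : ℕ) : Prog
  /-- `x_a := x_b * x_c` -/
  | mul (a b c : ℕ) : Prog
  /-- `x_a := x_b / x_c` -/
  | div (a b c : ℕ) : Prog
  /-- `x_a := √ x_b` -/
  | sqrt (a b : ℕ) : Prog
  /-- `x_a := m[p_i]` -/
  | load (a i : ℕ) : Prog
  /-- `m[p_i] := x_a` -/
  | store (i a : ℕ) : Prog
  /-- `p_i := k` -/
  | idxConst (i k : ℕ) : Prog
  /-- `p_i := p_j + p_k` -/
  | idxAdd (i j k : ℕ) : Prog
  /-- first `P`, then `Q` -/
  | seq (P Q : Prog) : Prog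
  /-- if `x_a < x_b` then `P` else `Q` -/
  | ifLt (a b : ℕ) (P Q : Prog) : Prog
  /-- repeat `P` as often as the value of `p_i` on entry says -/
  | loop (i : ℕ) (P : Prog) : Prog

/-- Machine states.  `steps` is the number of steps executed so far, and `space` is the least `N`
such that only the memory cells `m[0], …, m[N-1]` have been accessed so far. -/
structure State : Type where
  real : ℕ → ℝ
  idx : ℕ → ℕ
  mem : ℕ → ℝ
  steps : ℕ
  space : ℕ

namespace State

/-- Count one step. -/
def tick (s : State) : State := { s with steps := s.steps + 1 }

/-- Assign a real register, in one step. -/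
def setReal (s : State) (a : ℕ) (v : ℝ) : State :=
  { s with real := Function.update s.real a v, steps := s.steps + 1 }

/-- Assign an index register, in one step. -/
def setIdx (s : State) (i k : ℕ) : State :=
  { s with idx := Function.update s.idx i k, steps := s.steps + 1 }

/-- Record an access to the memory cell with address `k`. -/
def touch (s : State) (k : ℕ) : State := { s with space := max s.space (k + 1) }

/-- Write a memory cell, in one step. -/
def setMem (s : State) (k : ℕ) (v : ℝ) : State :=
  { s with mem := Function.update s.mem k v, steps := s.steps + 1 }

end State

/-- The effect of running a program.  Every elementary instruction takes one step, and so do every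
comparison, every entry into a loop and every iteration of a loop (in addition to its body). -/
def run : Prog → State → State
  | .skip, s => s
  | .const a q, s => s.setReal a q
  | .add a b c, s => s.setReal a (s.real b + s.real c)
  | .sub a b c, s => s.setReal a (s.real b - s.real c)
  | .mul a b c, s => s.setReal a (s.real b * s.real c)
  | .div a b c, s => s.setReal a (s.real b / s.real c)
  | .sqrt a b, s => s.setReal a (Real.sqrt (s.real b))
  | .load a i, s => (s.setReal a (s.mem (s.idx i))).touch (s.idx i)
  | .store i a, s => (s.setMem (s.idx i) (s.real a)).touch (s.idx i)
  | .idxConst i k, s => s.setIdx i k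
  | .idxAdd i j k, s => s.setIdx i (s.idx j + s.idx k)
  | .seq P Q, s => run Q (run P s)
  | .ifLt a b P Q, s => if s.real a < s.real b then run P s.tick else run Q s.tick
  | .loop i P, s => (fun t => run P t.tick)^[s.idx i] s.tick

end RealRAM

/-- A fresh machine state that holds the input `(n, r, ϱ, w, y)`: the number `n` is in the index
register `p₀`, the coordinates of `w` are in the cells `m[0], …, m[d-1]`, and the `n` records
`(rᵢ, ϱᵢ, yᵢ)` of length `d + 2` follow one after the other.  All other registers and cells may
have arbitrary contents. -/
structure HoldsInput (r ϱ : Fin n → ℝ) (w : Vec d) (y : Fin n → Vec d)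
    (s : RealRAM.State) : Prop where
  steps : s.steps = 0
  space : s.space = 0
  size : s.idx 0 = n
  mem_w : ∀ k : Fin d, s.mem k = w k
  mem_r : ∀ i : Fin n, s.mem (d + i * (d + 2)) = r i
  mem_ϱ : ∀ i : Fin n, s.mem (d + i * (d + 2) + 1) = ϱ i
  mem_y : ∀ (i : Fin n) (k : Fin d), s.mem (d + i * (d + 2) + 2 + k) = y i k

end ConformalPolygon

end

/-!
The director of `w` towards `x ∈ 𝕊` is, up to a positive factor, `σ(w, x)`; so `w` is a conformal
barycenter of `x` exactly when `(σ(w, xᵢ))ᵢ` is a closed polygon. It is also minus the gradient of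
the Busemann function of `x`. These functions are convex along hyperbolic geodesics, strictly so
unless the geodesic ends at `x`, which gives uniqueness; and because no `rⱼ` reaches half of the
total weight, their weighted sum is proper, which gives existence. As `σ(w, ·)` inverts `σ(-w, ·)`,
opening and closing are mutually inverse bijections. At a barycenter `w`, the differential of
`∑ rᵢ σ(w, xᵢ)` in `w` is a multiple of `∑ rᵢ (I - yᵢ yᵢᵀ)` with `yᵢ = σ(w, xᵢ)`, which is positive
definite as the `yᵢ` do not lie on a line; the implicit function theorem makes `w_*` smooth.

For the Jacobian, `σ(-w, ·)` acts on the tangent space of the sphere at `y` by a similarity of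
ratio `(1 - |w|²) / |w + y|²`, and moving `w` has the same effect as a tangent field along the
sphere. The Gram determinant of the opening map is thereby that of `(u, v) ↦ A u + v` on
`ℝᵈ × ker c`, where `c` is the differential of `∑ rᵢ yᵢ`; it is determined by the determinants of
`c ∘ c*`, of `c ∘ A`, and of the similarities.
-/

noncomputable section

namespace ConformalPolygon

section InnerProductSpace

variable {E : Type*} [NormedAddCommGroup E] [InnerProductSpace ℝ E]

theorem norm_smul_add_smul_sq (α β : ℝ) (a b : E) :
    ‖α • a + β • b‖ ^ 2 = α ^ 2 * ‖a‖ ^ 2 + 2 * (α * β) * inner ℝ a b + β ^ 2 * ‖b‖ ^ 2 := by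
  rw [norm_add_sq_real, norm_smul, norm_smul, real_inner_smul_left, real_inner_smul_right,
    mul_pow, mul_pow, Real.norm_eq_abs, Real.norm_eq_abs, sq_abs, sq_abs]
  ring

theorem norm_smul_add_smul_add_smul_sq (α β γ : ℝ) (a b c : E) :
    ‖α • a + β • b + γ • c‖ ^ 2 = α ^ 2 * ‖a‖ ^ 2 + β ^ 2 * ‖b‖ ^ 2 + γ ^ 2 * ‖c‖ ^ 2 +
      2 * (α * β) * inner ℝ a b + 2 * (α * γ) * inner ℝ a c + 2 * (β * γ) * inner ℝ b c := by
  rw [norm_add_sq_real, norm_smul_add_smul_sq, norm_smul, mul_pow, Real.norm_eq_abs, sq_abs,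
    inner_add_left, real_inner_smul_left, real_inner_smul_left, real_inner_smul_right,
    real_inner_smul_right]
  ring

theorem inner_sq_le_norm_sq {y : E} (hy : ‖y‖ = 1) (u : E) : inner ℝ y u ^ 2 ≤ ‖u‖ ^ 2 := by
  rw [sq_le_sq, abs_norm]
  simpa [hy] using abs_real_inner_le_norm y u

theorem eq_or_eq_neg_of_inner_sq_eq {y u : E} (hy : ‖y‖ = 1) (h : inner ℝ y u ^ 2 = ‖u‖ ^ 2) :
    ‖u‖ • y = u ∨ ‖u‖ • y = -u := by
  rcases sq_eq_sq_iff_eq_or_eq_neg.1 h with h | h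
  · left
    simpa [hy] using inner_eq_norm_mul_iff_real.1 (show inner ℝ y u = ‖y‖ * ‖u‖ by simp [h, hy])
  · right
    simpa [hy] using
      inner_eq_norm_mul_iff_real.1 (show inner ℝ y (-u) = ‖y‖ * ‖-u‖ by simp [h, hy])

end InnerProductSpace

section UnitBall

variable {d : ℕ} {w : Vec d}

theorem mem_unitBall_iff : w ∈ unitBall d ↔ ‖w‖ < 1 := mem_ball_zero_iff

theorem mem_unitBall_iff_norm_sq : w ∈ unitBall d ↔ ‖w‖ ^ 2 < 1 := by
  rw [mem_unitBall_iff, sq_lt_one_iff₀ (norm_nonneg w)]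

theorem norm_le_one_of_mem_unitBall (hw : w ∈ unitBall d) : ‖w‖ ≤ 1 := (mem_unitBall_iff.1 hw).le

theorem one_sub_norm_sq_pos (hw : w ∈ unitBall d) : 0 < 1 - ‖w‖ ^ 2 :=
  sub_pos.2 (mem_unitBall_iff_norm_sq.1 hw)

theorem neg_mem_unitBall (hw : w ∈ unitBall d) : -w ∈ unitBall d := by
  simpa only [mem_unitBall_iff, norm_neg] using hw

end UnitBall

/-! ### The shift map -/

section Shift

variable {d : ℕ} {w x z a b : Vec d}

/-- The denominator in the definition of `shift`. -/
def shiftDen (w z : Vec d) : ℝ := 1 - 2 * inner ℝ w z + ‖w‖ ^ 2 * ‖z‖ ^ 2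

theorem shiftDen_comm (w z : Vec d) : shiftDen w z = shiftDen z w := by
  rw [shiftDen, shiftDen, real_inner_comm, mul_comm (‖w‖ ^ 2)]

theorem shiftDen_pos (hw : w ∈ unitBall d) (hz : ‖z‖ ≤ 1) : 0 < shiftDen w z := by
  have hwz : ‖w‖ * ‖z‖ < 1 := by
    nlinarith [norm_nonneg w, norm_nonneg z, mem_unitBall_iff.1 hw]
  calc 0 < (1 - ‖w‖ * ‖z‖) ^ 2 := sq_pos_of_pos (sub_pos.2 hwz)
    _ ≤ shiftDen w z := by rw [shiftDen]; linarith [real_inner_le_norm w z]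

theorem shiftDen_of_norm_eq_one (hx : ‖x‖ = 1) : shiftDen w x = ‖x - w‖ ^ 2 := by
  rw [shiftDen, norm_sub_sq_real, hx, real_inner_comm]
  ring

theorem norm_sub_sq_pos (hw : w ∈ unitBall d) (hx : ‖x‖ = 1) : 0 < ‖x - w‖ ^ 2 :=
  shiftDen_of_norm_eq_one hx ▸ shiftDen_pos hw hx.le

theorem shift_eq (w z : Vec d) : shift w z = ((1 - ‖w‖ ^ 2) / shiftDen w z) • z +
    (-(1 + ‖z‖ ^ 2 - 2 * inner ℝ w z) / shiftDen w z) • w := by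
  rw [shift, ← shiftDen]
  module

theorem shift_self (w : Vec d) : shift w w = 0 := by
  rw [shift, real_inner_self_eq_norm_sq, ← sub_smul,
    show 1 - ‖w‖ ^ 2 - (1 + ‖w‖ ^ 2 - 2 * ‖w‖ ^ 2) = 0 by ring, zero_smul, smul_zero]

theorem shift_zero_right (w : Vec d) : shift w 0 = -w := by simp [shift]

theorem inner_shift (h : shiftDen w z ≠ 0) : inner ℝ w (shift w z) =
    ((1 + ‖w‖ ^ 2) * inner ℝ w z - (1 + ‖z‖ ^ 2) * ‖w‖ ^ 2) / shiftDen w z := by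
  rw [shift_eq, inner_add_right, real_inner_smul_right, real_inner_smul_right,
    real_inner_self_eq_norm_sq]
  field_simp
  ring

theorem one_sub_norm_shift_sq (h : shiftDen w z ≠ 0) :
    1 - ‖shift w z‖ ^ 2 = (1 - ‖w‖ ^ 2) * (1 - ‖z‖ ^ 2) / shiftDen w z := by
  rw [shift_eq, norm_smul_add_smul_sq, real_inner_comm w z]
  field_simp
  rw [shiftDen]
  ring

theorem norm_shift_sub_shift_sq (ha : shiftDen w a ≠ 0) (hb : shiftDen w b ≠ 0) :
    ‖shift w a - shift w b‖ ^ 2 =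
      (1 - ‖w‖ ^ 2) ^ 2 * ‖a - b‖ ^ 2 / (shiftDen w a * shiftDen w b) := by
  have hsub : shift w a - shift w b = ((1 - ‖w‖ ^ 2) / shiftDen w a) • a +
      (-((1 - ‖w‖ ^ 2) / shiftDen w b)) • b +
      (-(1 + ‖a‖ ^ 2 - 2 * inner ℝ w a) / shiftDen w a +
        (1 + ‖b‖ ^ 2 - 2 * inner ℝ w b) / shiftDen w b) • w := by
    rw [shift_eq, shift_eq]
    module
  rw [hsub, norm_smul_add_smul_add_smul_sq, norm_sub_sq_real, real_inner_comm w a,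
    real_inner_comm w b]
  field_simp
  rw [shiftDen, shiftDen]
  ring

theorem shiftDen_neg_shift (h : shiftDen w z ≠ 0) :
    shiftDen (-w) (shift w z) = (1 - ‖w‖ ^ 2) ^ 2 / shiftDen w z := by
  have hnorm : ‖shift w z‖ ^ 2 = 1 - (1 - ‖w‖ ^ 2) * (1 - ‖z‖ ^ 2) / shiftDen w z := by
    rw [← one_sub_norm_shift_sq h, sub_sub_cancel]
  rw [shiftDen, norm_neg, inner_neg_left, inner_shift h, hnorm]
  field_simp
  rw [shiftDen]
  ring

theorem shift_neg_shift (hw : w ∈ unitBall d) (hz : ‖z‖ ≤ 1) : shift (-w) (shift w z) = z := by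
  have hD := (shiftDen_pos hw hz).ne'
  have hq := (one_sub_norm_sq_pos hw).ne'
  have hcancel : 1 + ‖shift w z‖ ^ 2 - 2 * inner ℝ (-w) (shift w z) =
      (1 - ‖w‖ ^ 2) * ((1 + ‖z‖ ^ 2 - 2 * inner ℝ w z) / shiftDen w z) := by
    rw [inner_neg_left, inner_shift hD,
      show ‖shift w z‖ ^ 2 = 1 - (1 - ‖w‖ ^ 2) * (1 - ‖z‖ ^ 2) / shiftDen w z by
        rw [← one_sub_norm_shift_sq hD, sub_sub_cancel]]
    field_simp
    rw [shiftDen]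
    ring
  calc shift (-w) (shift w z)
    _ = ((1 - ‖w‖ ^ 2) ^ 2 / shiftDen w z)⁻¹ • ((1 - ‖w‖ ^ 2) • shift w z -
          ((1 - ‖w‖ ^ 2) * ((1 + ‖z‖ ^ 2 - 2 * inner ℝ w z) / shiftDen w z)) • -w) := by
      rw [shift, ← shiftDen, shiftDen_neg_shift hD, hcancel, norm_neg]
    _ = (((1 - ‖w‖ ^ 2) ^ 2 / shiftDen w z)⁻¹ * ((1 - ‖w‖ ^ 2) ^ 2 / shiftDen w z)) • z := by
      rw [shift_eq]
      module
    _ = z := by rw [inv_mul_cancel₀ (div_ne_zero (pow_ne_zero 2 hq) hD), one_smul]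

theorem shift_shift_neg (hw : w ∈ unitBall d) (hz : ‖z‖ ≤ 1) : shift w (shift (-w) z) = z := by
  simpa only [neg_neg] using shift_neg_shift (neg_mem_unitBall hw) hz

theorem shift_mem_unitBall (hw : w ∈ unitBall d) (hz : z ∈ unitBall d) :
    shift w z ∈ unitBall d := by
  have hD := shiftDen_pos hw (norm_le_one_of_mem_unitBall hz)
  rw [mem_unitBall_iff_norm_sq, ← sub_pos, one_sub_norm_shift_sq hD.ne']
  exact div_pos (mul_pos (one_sub_norm_sq_pos hw) (one_sub_norm_sq_pos hz)) hD

theorem norm_shift_eq_one (hw : w ∈ unitBall d) (hx : ‖x‖ = 1) : ‖shift w x‖ = 1 := by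
  have h := one_sub_norm_shift_sq (shiftDen_pos hw hx.le).ne'
  rw [hx, one_pow, sub_self, mul_zero, zero_div, sub_eq_zero, eq_comm] at h
  exact (pow_eq_one_iff_of_nonneg (norm_nonneg _) two_ne_zero).1 h

theorem shift_eq_of_norm_eq_one (hw : w ∈ unitBall d) (hx : ‖x‖ = 1) :
    shift w x = ((1 - ‖w‖ ^ 2) / ‖x - w‖ ^ 2) • (x - w) - w := by
  have h0 : 1 - 2 * inner ℝ w x + ‖w‖ ^ 2 ≠ 0 := by
    simpa only [shiftDen, hx, one_pow, mul_one] using (shiftDen_pos hw hx.le).ne'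
  have hw' : -(1 + ‖x‖ ^ 2 - 2 * inner ℝ w x) / shiftDen w x =
      -((1 - ‖w‖ ^ 2) / shiftDen w x) - 1 := by
    rw [shiftDen, hx, one_pow, mul_one]
    field_simp
    ring
  rw [shift_eq, hw', shiftDen_of_norm_eq_one hx]
  module

theorem eq_of_shift_eq_shift (hw : w ∈ unitBall d) (ha : ‖a‖ ≤ 1) (hb : ‖b‖ ≤ 1)
    (h : shift w a = shift w b) : a = b := by
  rw [← shift_neg_shift hw ha, h, shift_neg_shift hw hb]

theorem continuousAt_shift (hw : w ∈ unitBall d) (hz : ‖z‖ ≤ 1) : ContinuousAt (shift w) z := by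
  have h : 1 - 2 * inner ℝ w z + ‖w‖ ^ 2 * ‖z‖ ^ 2 ≠ 0 := (shiftDen_pos hw hz).ne'
  unfold shift
  fun_prop (disch := exact h)

theorem hasFDerivAt_shift_zero (w : Vec d) :
    HasFDerivAt (shift w) ((1 - ‖w‖ ^ 2) • ContinuousLinearMap.id ℝ (Vec d)) 0 := by
  have hid := hasFDerivAt_id (𝕜 := ℝ) (0 : Vec d)
  have hinner := (innerSL ℝ w).hasFDerivAt (x := 0)
  have hnum := (hid.const_smul (1 - ‖w‖ ^ 2)).sub
    (((hid.norm_sq.const_add 1).sub (hinner.const_mul 2)).smul_const w)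
  have hden := ((hinner.const_mul 2).const_sub 1).add (hid.norm_sq.const_mul (‖w‖ ^ 2))
  have hshift := ((hasFDerivAt_inv (by simp)).comp (0 : Vec d) hden).smul hnum
  refine hshift.congr_fderiv (ContinuousLinearMap.ext fun u => ?_)
  simp

end Shift

/-! ### Geodesic rays and directors -/

section HyperbolicTangent

open Filter Topology

theorem tendsto_tanh_atTop : Tendsto Real.tanh atTop (𝓝 1) := by
  have hexp : Tendsto (fun x : ℝ => 2 / (Real.exp (2 * x) + 1)) atTop (𝓝 0) :=
    tendsto_const_nhds.div_atTop <| tendsto_atTop_add_const_right _ _ <|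
      Real.tendsto_exp_atTop.comp (tendsto_id.const_mul_atTop two_pos)
  have htanh (x : ℝ) : 1 - 2 / (Real.exp (2 * x) + 1) = Real.tanh x := by
    rw [Real.tanh_eq, Real.exp_neg, two_mul, Real.exp_add]
    field_simp
    ring
  simpa only [htanh, sub_zero] using hexp.const_sub 1

theorem one_sub_tanh_sq (t : ℝ) : 1 - Real.tanh t ^ 2 = (Real.cosh t ^ 2)⁻¹ := by
  have hcosh := (Real.cosh_pos t).ne'
  rw [Real.tanh_eq_sinh_div_cosh]
  field_simp
  linarith [Real.cosh_sq t]

theorem tanh_sub_tanh (s t : ℝ) :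
    Real.tanh s - Real.tanh t = Real.sinh (s - t) / (Real.cosh s * Real.cosh t) := by
  have hs := (Real.cosh_pos s).ne'
  have ht := (Real.cosh_pos t).ne'
  rw [Real.tanh_eq_sinh_div_cosh, Real.tanh_eq_sinh_div_cosh, Real.sinh_sub]
  field_simp

theorem cosh_sub_eq_tanh_half (s t : ℝ) : Real.cosh (s - t) =
    1 + 2 * (Real.tanh (s / 2) - Real.tanh (t / 2)) ^ 2 /
      ((1 - Real.tanh (s / 2) ^ 2) * (1 - Real.tanh (t / 2) ^ 2)) := by
  have hs := (Real.cosh_pos (s / 2)).ne'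
  have ht := (Real.cosh_pos (t / 2)).ne'
  rw [one_sub_tanh_sq, one_sub_tanh_sq, tanh_sub_tanh, show s - t = 2 * (s / 2 - t / 2) by ring,
    Real.cosh_two_mul, Real.cosh_sq]
  field_simp
  ring

theorem hasDerivAt_tanh_zero : HasDerivAt Real.tanh 1 0 := by
  have h := (Real.hasDerivAt_sinh 0).fun_div (Real.hasDerivAt_cosh 0) (Real.cosh_pos 0).ne'
  simpa [← Real.tanh_eq_sinh_div_cosh] using h

end HyperbolicTangent

section HyperbolicDistance

variable {d : ℕ} {u v w : Vec d}

theorem cosh_hypDist (hu : u ∈ unitBall d) (hv : v ∈ unitBall d) :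
    Real.cosh (hypDist u v) = 1 + 2 * ‖u - v‖ ^ 2 / ((1 - ‖u‖ ^ 2) * (1 - ‖v‖ ^ 2)) := by
  have hu' := one_sub_norm_sq_pos hu
  have hv' := one_sub_norm_sq_pos hv
  exact Real.cosh_arcosh (le_add_of_nonneg_right (by positivity))

theorem hypDist_shift (hw : w ∈ unitBall d) (hu : u ∈ unitBall d) (hv : v ∈ unitBall d) :
    hypDist (shift w u) (shift w v) = hypDist u v := by
  have hDu := (shiftDen_pos hw (norm_le_one_of_mem_unitBall hu)).ne'
  have hDv := (shiftDen_pos hw (norm_le_one_of_mem_unitBall hv)).ne'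
  have hw' := (one_sub_norm_sq_pos hw).ne'
  have hu' := (one_sub_norm_sq_pos hu).ne'
  have hv' := (one_sub_norm_sq_pos hv).ne'
  rw [hypDist, hypDist, one_sub_norm_shift_sq hDu, one_sub_norm_shift_sq hDv,
    norm_shift_sub_shift_sq hDu hDv]
  congr 2
  field_simp

theorem hypDist_tanh_smul (hu : ‖u‖ = 1) (s t : ℝ) :
    hypDist (Real.tanh (s / 2) • u) (Real.tanh (t / 2) • u) = |s - t| := by
  rw [← Real.arcosh_cosh (abs_nonneg (s - t)), Real.cosh_abs, cosh_sub_eq_tanh_half, hypDist,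
    ← sub_smul]
  simp only [norm_smul, hu, mul_one, Real.norm_eq_abs, sq_abs]

theorem norm_eq_tanh_half_hypDist (hu : u ∈ unitBall d) : ‖u‖ = Real.tanh (hypDist u 0 / 2) := by
  have htanh : Real.tanh (Real.artanh ‖u‖) = ‖u‖ :=
    Real.tanh_artanh ⟨by linarith [norm_nonneg u], mem_unitBall_iff.1 hu⟩
  have hcosh := cosh_sub_eq_tanh_half (2 * Real.artanh ‖u‖) 0
  rw [mul_div_cancel_left₀ _ two_ne_zero, htanh, sub_zero, zero_div, Real.tanh_zero] at hcosh
  have hdist : hypDist u 0 = 2 * Real.artanh ‖u‖ := by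
    rw [hypDist, sub_zero, norm_zero, ← Real.arcosh_cosh (x := 2 * Real.artanh ‖u‖)
      (mul_nonneg zero_le_two (Real.artanh_nonneg (norm_nonneg u))), hcosh, sub_zero]
  rw [hdist, mul_div_cancel_left₀ _ two_ne_zero, htanh]

theorem sameRay_of_hypDist (hu : u ∈ unitBall d) (hv : v ∈ unitBall d)
    (h : hypDist u v = |hypDist u 0 - hypDist v 0|) : SameRay ℝ u v := by
  have hden := mul_pos (one_sub_norm_sq_pos hu) (one_sub_norm_sq_pos hv)
  have hcosh := cosh_hypDist hu hv
  rw [h, Real.cosh_abs, cosh_sub_eq_tanh_half, ← norm_eq_tanh_half_hypDist hu,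
    ← norm_eq_tanh_half_hypDist hv, add_right_inj, div_left_inj' hden.ne',
    mul_right_inj' two_ne_zero] at hcosh
  rw [sameRay_iff_norm_sub, ← abs_norm (u - v)]
  exact (sq_eq_sq_iff_abs_eq_abs _ _).1 hcosh.symm

end HyperbolicDistance

section Directors

open Filter Topology

variable {d : ℕ} {w x u v : Vec d} {γ : ℝ → Vec d}

theorem isGeodesicRay_tanh_smul (hx : ‖x‖ = 1) :
    IsGeodesicRay 0 x fun t => Real.tanh (t / 2) • x where
  mem_ball t _ := by
    rw [mem_unitBall_iff, norm_smul, hx, mul_one, Real.norm_eq_abs]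
    exact Real.abs_tanh_lt_one _
  isometry s t _ _ := hypDist_tanh_smul hx s t
  start := by simp
  limit := by
    simpa using (tendsto_tanh_atTop.comp (tendsto_id.atTop_div_const two_pos)).smul_const x

theorem IsGeodesicRay.shift (h : IsGeodesicRay u x γ) (hw : w ∈ unitBall d) (hx : ‖x‖ ≤ 1) :
    IsGeodesicRay (shift w u) (shift w x) fun t => shift w (γ t) where
  mem_ball t ht := shift_mem_unitBall hw (h.mem_ball t ht)
  isometry s t hs ht := by
    rw [hypDist_shift hw (h.mem_ball s hs) (h.mem_ball t ht), h.isometry s t hs ht]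
  start := by rw [h.start]
  limit := (continuousAt_shift hw hx).tendsto.comp h.limit

theorem IsGeodesicRay.eq_tanh_smul (h : IsGeodesicRay 0 x γ) (hx : ‖x‖ = 1) {t : ℝ}
    (ht : 0 ≤ t) : γ t = Real.tanh (t / 2) • x := by
  have hdist {s : ℝ} (hs : 0 ≤ s) : hypDist (γ s) 0 = s := by
    rw [← h.start, h.isometry s 0 hs le_rfl, sub_zero, abs_of_nonneg hs]
  have hray : ∀ᶠ s in atTop, ‖γ s‖ • γ t = ‖γ t‖ • γ s := by
    filter_upwards [eventually_ge_atTop 0] with s hs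
    refine (sameRay_of_hypDist (h.mem_ball s hs) (h.mem_ball t ht) ?_).norm_smul_eq
    rw [hdist hs, hdist ht, h.isometry s t hs ht]
  have hlim := tendsto_nhds_unique_of_eventuallyEq (h.limit.norm.smul_const (γ t))
    (h.limit.const_smul ‖γ t‖) hray
  rwa [hx, one_smul, norm_eq_tanh_half_hypDist (h.mem_ball t ht), hdist ht] at hlim

/-- The unit speed parametrization of the hyperbolic geodesic ray from `w` to the ideal point `x`,
obtained by moving a radius of the ball with `shift (-w)`. -/
def geodesicRay (w x : Vec d) (t : ℝ) : Vec d := shift (-w) (Real.tanh (t / 2) • shift w x)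

theorem isGeodesicRay_geodesicRay (hw : w ∈ unitBall d) (hx : ‖x‖ = 1) :
    IsGeodesicRay w x (geodesicRay w x) := by
  have hz := norm_shift_eq_one hw hx
  have h := (isGeodesicRay_tanh_smul hz).shift (neg_mem_unitBall hw) hz.le
  rwa [shift_zero_right, neg_neg, shift_neg_shift hw hx.le] at h

theorem IsGeodesicRay.eq_geodesicRay (h : IsGeodesicRay w x γ) (hw : w ∈ unitBall d)
    (hx : ‖x‖ = 1) {t : ℝ} (ht : 0 ≤ t) : γ t = geodesicRay w x t := by
  have hshift := h.shift hw hx.le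
  rw [shift_self] at hshift
  rw [geodesicRay, ← hshift.eq_tanh_smul (norm_shift_eq_one hw hx) ht,
    shift_neg_shift hw (norm_le_one_of_mem_unitBall (h.mem_ball t ht))]

theorem hasDerivAt_geodesicRay (w x : Vec d) :
    HasDerivAt (geodesicRay w x) (((1 - ‖w‖ ^ 2) / 2) • shift w x) 0 := by
  have htanh : HasDerivAt (fun t : ℝ => Real.tanh (t / 2)) (1 * (1 / 2)) 0 :=
    hasDerivAt_tanh_zero.comp_of_eq 0 ((hasDerivAt_id (0 : ℝ)).div_const 2) (zero_div 2).symm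
  have hray := (hasFDerivAt_shift_zero (-w)).comp_hasDerivAt_of_eq (0 : ℝ)
    (htanh.smul_const (shift w x)) (by simp)
  refine hray.congr_deriv ?_
  simp [smul_smul, div_eq_inv_mul]

theorem isDirector_iff (hw : w ∈ unitBall d) (hx : ‖x‖ = 1) :
    IsDirector w x v ↔ v = ((1 - ‖w‖ ^ 2) / 2) • shift w x := by
  have hderiv := (hasDerivAt_geodesicRay w x).hasDerivWithinAt (s := Set.Ici 0)
  constructor
  · rintro ⟨γ, hγ, hv⟩
    have hv' := hv.congr (fun t ht => (hγ.eq_geodesicRay hw hx ht).symm)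
      (hγ.eq_geodesicRay hw hx le_rfl).symm
    exact (uniqueDiffOn_Ici (0 : ℝ) 0 Set.self_mem_Ici).eq_deriv _ hv' hderiv
  · rintro rfl
    exact ⟨_, isGeodesicRay_geodesicRay hw hx, hderiv⟩

theorem isConformalBarycenter_iff {n : ℕ} {r : Fin n → ℝ} {x : Fin n → Vec d} (hx : x ∈ Arm d n) :
    IsConformalBarycenter r x w ↔ w ∈ unitBall d ∧ ∑ i, r i • shift w (x i) = 0 := by
  refine and_congr_right fun hw => ?_
  have hq : (1 - ‖w‖ ^ 2) / 2 ≠ 0 := (half_pos (one_sub_norm_sq_pos hw)).ne'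
  simp only [fun i v => isDirector_iff (v := v) hw (hx i), ← funext_iff, exists_eq_left,
    smul_comm (r _), ← Finset.smul_sum, smul_eq_zero_iff_right hq]

end Directors

/-! ### Existence and uniqueness of the conformal barycenter -/

section Barycenter

open Filter Topology

variable {d n : ℕ} {r : Fin n → ℝ} {x y : Fin n → Vec d} {u w w' z : Vec d}

theorem exists_inner_sq_lt (hn : 3 ≤ n) (hy : y ∈ ArmX d n) (hu : u ≠ 0) :
    ∃ i, inner ℝ (y i) u ^ 2 < ‖u‖ ^ 2 := by
  by_contra! hge
  have hparallel (i) : ‖u‖ • y i = u ∨ ‖u‖ • y i = -u :=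
    eq_or_eq_neg_of_inner_sq_eq (hy.1 i) ((inner_sq_le_norm_sq (hy.1 i) u).antisymm (hge i))
  have hdistinct (i j : Fin n) (hij : i ≠ j) : ‖u‖ • y i ≠ ‖u‖ • y j := fun h =>
    hy.2 i j hij (smul_right_injective _ (norm_ne_zero_iff.2 hu) h)
  let i₀ : Fin n := ⟨0, by lia⟩
  let i₁ : Fin n := ⟨1, by lia⟩
  let i₂ : Fin n := ⟨2, by lia⟩
  have h₀₁ := hdistinct i₀ i₁ (by simp [i₀, i₁])
  have h₀₂ := hdistinct i₀ i₂ (by simp [i₀, i₂])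
  have h₁₂ := hdistinct i₁ i₂ (by simp [i₁, i₂])
  grind

theorem sum_norm_sq_sub_inner_sq_pos (hn : 3 ≤ n) (hy : y ∈ ArmX d n) {c : Fin n → ℝ}
    (hc : ∀ i, 0 < c i) (hu : u ≠ 0) : 0 < ∑ i, c i * (‖u‖ ^ 2 - inner ℝ (y i) u ^ 2) := by
  obtain ⟨i, hi⟩ := exists_inner_sq_lt hn hy hu
  exact Finset.sum_pos'
    (fun i _ => mul_nonneg (hc i).le (sub_nonneg.2 (inner_sq_le_norm_sq (hy.1 i) u)))
    ⟨i, Finset.mem_univ i, mul_pos (hc i) (sub_pos.2 hi)⟩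

theorem shift_mem_ArmX (hw : w ∈ unitBall d) (hx : x ∈ ArmX d n) :
    (fun i => shift w (x i)) ∈ ArmX d n :=
  ⟨fun i => norm_shift_eq_one hw (hx.1 i), fun i j hij h =>
    hx.2 i j hij (eq_of_shift_eq_shift hw (hx.1 i).le (hx.1 j).le h)⟩

/-- Quantitative form of the monotonicity of the director field `-V_z` along the geodesic from `w`
to `w'`: the right-hand side is nonnegative, and it vanishes only if `z` is an end of that
geodesic. -/
theorem inner_shift_add_inner_shift (hw : w ∈ unitBall d) (hw' : w' ∈ unitBall d) (hz : ‖z‖ = 1) :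
    inner ℝ (shift w z) (shift w w') + inner ℝ (shift w' z) (shift w' w) =
      2 / ‖shift w z - shift w w'‖ ^ 2 *
        (‖shift w w'‖ ^ 2 - inner ℝ (shift w z) (shift w w') ^ 2) := by
  have hD := (shiftDen_pos hw (norm_le_one_of_mem_unitBall hw')).ne'
  have hD' : shiftDen w' w ≠ 0 := shiftDen_comm w w' ▸ hD
  have hDz := (shiftDen_pos hw hz.le).ne'
  have hDz' := (shiftDen_pos hw' hz.le).ne'
  have hnorm : ‖shift w' w‖ ^ 2 = ‖shift w w'‖ ^ 2 := by
    have h := one_sub_norm_shift_sq hD'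
    rw [shiftDen_comm, mul_comm, ← one_sub_norm_shift_sq hD] at h
    linarith
  have hpos := norm_sub_sq_pos (shift_mem_unitBall hw hw') (norm_shift_eq_one hw hz)
  have hdist : ‖shift w z - shift w w'‖ ^ 2 =
      1 + ‖shift w w'‖ ^ 2 - 2 * inner ℝ (shift w z) (shift w w') := by
    rw [norm_sub_sq_real, norm_shift_eq_one hw hz]
    ring
  have hdist' : ‖shift w' z - shift w' w‖ ^ 2 =
      1 + ‖shift w w'‖ ^ 2 - 2 * inner ℝ (shift w' z) (shift w' w) := by
    rw [norm_sub_sq_real, norm_shift_eq_one hw' hz, hnorm]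
    ring
  have hprod : ‖shift w z - shift w w'‖ ^ 2 * ‖shift w' z - shift w' w‖ ^ 2 =
      (1 - ‖shift w w'‖ ^ 2) ^ 2 := by
    rw [norm_shift_sub_shift_sq hDz hD, norm_shift_sub_shift_sq hDz' hD', one_sub_norm_shift_sq hD,
      shiftDen_comm w' w, ← shiftDen_of_norm_eq_one hz, ← shiftDen_of_norm_eq_one hz]
    field_simp
  rw [hdist] at hpos ⊢
  rw [hdist, hdist'] at hprod
  rw [div_mul_eq_mul_div, eq_div_iff hpos.ne']
  linear_combination -(1 / 2) * hprod

theorem sum_mul_inner_eq_zero (h : ∑ i, r i • y i = 0) (u : Vec d) :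
    ∑ i, r i * inner ℝ (y i) u = 0 := by
  simpa only [sum_inner, real_inner_smul_left, inner_zero_left] using congrArg (inner ℝ · u) h

theorem eq_of_sum_smul_shift_eq_zero (hn : 3 ≤ n) (hr : ∀ i, 0 < r i) (hx : x ∈ ArmX d n)
    (hw : w ∈ unitBall d) (hw' : w' ∈ unitBall d)
    (h : ∑ i, r i • shift w (x i) = 0) (h' : ∑ i, r i • shift w' (x i) = 0) : w = w' := by
  by_contra hne
  have hv : shift w w' ≠ 0 := fun hv => hne <|
    eq_of_shift_eq_shift hw (norm_le_one_of_mem_unitBall hw) (norm_le_one_of_mem_unitBall hw')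
      ((shift_self w).trans hv.symm)
  have hc (i) : 0 < r i * (2 / ‖shift w (x i) - shift w w'‖ ^ 2) := mul_pos (hr i) <|
    div_pos two_pos (norm_sub_sq_pos (shift_mem_unitBall hw hw') (norm_shift_eq_one hw (hx.1 i)))
  have hpos := sum_norm_sq_sub_inner_sq_pos hn (shift_mem_ArmX hw hx) hc hv
  simp only [mul_assoc, ← inner_shift_add_inner_shift hw hw' (hx.1 _), mul_add,
    Finset.sum_add_distrib, sum_mul_inner_eq_zero h, sum_mul_inner_eq_zero h', add_zero,
    lt_irrefl] at hpos

/-- The weighted sum of the Busemann functions of the ideal points `xᵢ`, normalised to vanish at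
`0`; the conformal barycenters of `x` are its critical points. -/
def barycenterPotential (r : Fin n → ℝ) (x : Fin n → Vec d) (w : Vec d) : ℝ :=
  ∑ i, r i * (Real.log (‖x i - w‖ ^ 2) - Real.log (1 - ‖w‖ ^ 2))

theorem barycenterPotential_zero (hx : x ∈ Arm d n) : barycenterPotential r x 0 = 0 := by
  simp [barycenterPotential, hx _]

theorem continuousAt_barycenterPotential (hx : x ∈ Arm d n) (hw : w ∈ unitBall d) :
    ContinuousAt (barycenterPotential r x) w := by
  have hdist (i) : ‖x i - w‖ ^ 2 ≠ 0 := (norm_sub_sq_pos hw (hx i)).ne'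
  have hball : 1 - ‖w‖ ^ 2 ≠ 0 := (one_sub_norm_sq_pos hw).ne'
  refine tendsto_finsetSum _ fun i _ => ContinuousAt.mul continuousAt_const ?_
  exact ContinuousAt.sub (ContinuousAt.log (by fun_prop) (hdist i))
    (ContinuousAt.log (by fun_prop) hball)

theorem hasDerivAt_log_norm_sub_sq_sub_log (hw : w ∈ unitBall d) (hz : ‖z‖ = 1) (u : Vec d) :
    HasDerivAt (fun t : ℝ => Real.log (‖z - (w + t • u)‖ ^ 2) - Real.log (1 - ‖w + t • u‖ ^ 2))
      (-(2 / (1 - ‖w‖ ^ 2)) * inner ℝ (shift w z) u) 0 := by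
  have hdist := (norm_sub_sq_pos hw hz).ne'
  have hball := (one_sub_norm_sq_pos hw).ne'
  have hline : HasDerivAt (fun t : ℝ => w + t • u) u 0 := by
    simpa using ((hasDerivAt_id (0 : ℝ)).smul_const u).const_add w
  have hlog := ((hline.const_sub z).norm_sq.log (by simpa using hdist)).sub
    ((hline.norm_sq.const_sub 1).log (by simpa using hball))
  refine hlog.congr_deriv ?_
  simp only [zero_smul, add_zero, inner_neg_right]
  rw [shift_eq_of_norm_eq_one hw hz, inner_sub_left (_ • _) w, real_inner_smul_left]
  field_simp
  ring

theorem hasDerivAt_barycenterPotential (hx : x ∈ Arm d n) (hw : w ∈ unitBall d) (u : Vec d) :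
    HasDerivAt (fun t : ℝ => barycenterPotential r x (w + t • u))
      (-(2 / (1 - ‖w‖ ^ 2)) * inner ℝ (∑ i, r i • shift w (x i)) u) 0 := by
  refine (HasDerivAt.fun_sum fun i _ =>
    (hasDerivAt_log_norm_sub_sq_sub_log hw (hx i) u).const_mul (r i)).congr_deriv ?_
  rw [sum_inner, Finset.mul_sum]
  refine Finset.sum_congr rfl fun i _ => ?_
  rw [real_inner_smul_left]
  ring

theorem eventually_exists_forall_ne_le_dist {ι X : Type*} [Finite ι] [Nonempty ι] [MetricSpace X]
    {x : ι → X} (hx : Function.Injective x) :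
    ∀ᶠ δ in 𝓝[>] (0 : ℝ), ∀ w, ∃ j, ∀ i, i ≠ j → δ ≤ dist (x i) w := by
  have hsep : ∀ᶠ δ in 𝓝[>] (0 : ℝ), ∀ i j, i ≠ j → 2 * δ < dist (x i) (x j) := by
    refine eventually_all.2 fun i => eventually_all.2 fun j => ?_
    by_cases hij : i = j
    · simp [hij]
    · have hlim : Tendsto (fun δ : ℝ => 2 * δ) (𝓝[>] 0) (𝓝 0) :=
        (Continuous.tendsto' (by fun_prop) _ _ (mul_zero _)).mono_left nhdsWithin_le_nhds
      exact (hlim.eventually_lt_const (dist_pos.2 (hx.ne hij))).mono fun _ h _ => h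
  filter_upwards [hsep] with δ hδ w
  by_contra! hcon
  obtain ⟨j, -, hj⟩ := hcon (Classical.arbitrary ι)
  obtain ⟨i, hij, hi⟩ := hcon j
  linarith [hδ i j hij, dist_triangle_right (x i) (x j) w]

theorem le_log_norm_sub_sq_sub_log (hw : w ∈ unitBall d) {c : ℝ} (hc : 0 < c)
    (h : c ≤ ‖z - w‖) : 2 * Real.log c - Real.log 2 - Real.log (1 - ‖w‖) ≤
      Real.log (‖z - w‖ ^ 2) - Real.log (1 - ‖w‖ ^ 2) := by
  have hε : 0 < 1 - ‖w‖ := sub_pos.2 (mem_unitBall_iff.1 hw)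
  have hdist : 2 * Real.log c ≤ Real.log (‖z - w‖ ^ 2) := by
    rw [Real.log_pow, Nat.cast_ofNat]
    gcongr
  have hball : Real.log (1 - ‖w‖ ^ 2) ≤ Real.log 2 + Real.log (1 - ‖w‖) := by
    rw [← Real.log_mul two_ne_zero hε.ne']
    exact Real.log_le_log (one_sub_norm_sq_pos hw) (by nlinarith [norm_nonneg w])
  linarith

/-- Stability (`2 rⱼ < ∑ rᵢ`) makes the potential proper: near the sphere `w` is close to at most
one `xⱼ`, and then the other terms outweigh the one with index `j`. -/
theorem exists_le_barycenterPotential [Nonempty (Fin n)] (hr : ∀ i, 0 < r i)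
    (hr2 : ∀ j, r j < (1 / 2) * ∑ i, r i) (hx : x ∈ ArmX d n) : ∃ K η : ℝ, 0 < η ∧
      ∀ w ∈ unitBall d, K - η * Real.log (1 - ‖w‖) ≤ barycenterPotential r x w := by
  have hinj : Function.Injective x := fun i j h => by_contra fun hij => hx.2 i j hij h
  obtain ⟨δ, hδ, hδ0, hδ1⟩ := ((eventually_exists_forall_ne_le_dist hinj).and
    (Ioc_mem_nhdsGT one_pos)).exists
  obtain ⟨k, hk⟩ := Finite.exists_max r
  refine ⟨∑ i, r i * (2 * Real.log δ - Real.log 2), ∑ i, r i - 2 * r k, by linarith [hr2 k],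
    fun w hw => ?_⟩
  obtain ⟨j, hj⟩ := hδ w
  have hε : 0 < 1 - ‖w‖ := sub_pos.2 (mem_unitBall_iff.1 hw)
  have hterm (i) : r i * (2 * Real.log δ - Real.log 2 - Real.log (1 - ‖w‖)) +
      (if i = j then r j * (2 * Real.log (1 - ‖w‖)) else 0) ≤
        r i * (Real.log (‖x i - w‖ ^ 2) - Real.log (1 - ‖w‖ ^ 2)) := by
    split_ifs with hij
    · subst hij
      have hnear : 1 - ‖w‖ ≤ ‖x i - w‖ := by simpa [hx.1 i] using norm_sub_norm_le (x i) w
      rw [← mul_add]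
      refine mul_le_mul_of_nonneg_left ?_ (hr i).le
      linarith [le_log_norm_sub_sq_sub_log hw hε hnear, Real.log_nonpos hδ0.le hδ1]
    · rw [add_zero]
      exact mul_le_mul_of_nonneg_left
        (le_log_norm_sub_sq_sub_log hw hδ0 (dist_eq_norm (x i) w ▸ hj i hij)) (hr i).le
  have hlog : Real.log (1 - ‖w‖) ≤ 0 := Real.log_nonpos hε.le (by simp)
  calc ∑ i, r i * (2 * Real.log δ - Real.log 2) - (∑ i, r i - 2 * r k) * Real.log (1 - ‖w‖)
    _ ≤ ∑ i, r i * (2 * Real.log δ - Real.log 2) - (∑ i, r i - 2 * r j) * Real.log (1 - ‖w‖) := by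
      nlinarith [hk j]
    _ = ∑ i, (r i * (2 * Real.log δ - Real.log 2 - Real.log (1 - ‖w‖)) +
          if i = j then r j * (2 * Real.log (1 - ‖w‖)) else 0) := by
      rw [Finset.sum_add_distrib, Finset.sum_ite_eq' Finset.univ j, if_pos (Finset.mem_univ j),
        ← Finset.sum_mul, ← Finset.sum_mul]
      ring
    _ ≤ barycenterPotential r x w := Finset.sum_le_sum fun i _ => hterm i

theorem exists_barycenterPotential_pos [Nonempty (Fin n)] (hr : ∀ i, 0 < r i)
    (hr2 : ∀ j, r j < (1 / 2) * ∑ i, r i) (hx : x ∈ ArmX d n) :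
    ∃ ρ : ℝ, 0 ≤ ρ ∧ ρ < 1 ∧ ∀ w ∈ unitBall d, ρ ≤ ‖w‖ → 0 < barycenterPotential r x w := by
  obtain ⟨K, η, hη, hK⟩ := exists_le_barycenterPotential hr hr2 hx
  refine ⟨max 0 (1 - Real.exp ((K - 1) / η)), le_max_left _ _,
    max_lt one_pos (by linarith [Real.exp_pos ((K - 1) / η)]), fun w hw hρ => ?_⟩
  have hlog : Real.log (1 - ‖w‖) ≤ (K - 1) / η :=
    (Real.log_le_iff_le_exp (sub_pos.2 (mem_unitBall_iff.1 hw))).2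
      (by linarith [le_of_max_le_right hρ])
  rw [le_div_iff₀ hη] at hlog
  linarith [hK w hw]

theorem sum_smul_shift_eq_zero_of_isLocalMin (hx : x ∈ Arm d n) (hw : w ∈ unitBall d)
    (hmin : IsLocalMin (barycenterPotential r x) w) : ∑ i, r i • shift w (x i) = 0 := by
  refine ext_inner_right ℝ fun u => ?_
  have hline : Tendsto (fun t : ℝ => w + t • u) (𝓝 0) (𝓝 w) :=
    Continuous.tendsto' (by fun_prop) _ _ (by simp)
  have hminLine : IsLocalMin (fun t : ℝ => barycenterPotential r x (w + t • u)) 0 := by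
    simpa [IsLocalMin, IsMinFilter] using hline.eventually hmin
  have hderiv := hminLine.hasDerivAt_eq_zero (hasDerivAt_barycenterPotential hx hw u)
  have hq := one_sub_norm_sq_pos hw
  rw [inner_zero_left]
  exact (mul_eq_zero.1 hderiv).resolve_left (by simp [hq.ne'])

theorem exists_sum_smul_shift_eq_zero [Nonempty (Fin n)] (hr : ∀ i, 0 < r i)
    (hr2 : ∀ j, r j < (1 / 2) * ∑ i, r i) (hx : x ∈ ArmX d n) :
    ∃ w ∈ unitBall d, ∑ i, r i • shift w (x i) = 0 := by
  obtain ⟨ρ, hρ0, hρ1, hρ⟩ := exists_barycenterPotential_pos hr hr2 hx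
  have hsub : Metric.closedBall 0 ρ ⊆ unitBall d := Metric.closedBall_subset_ball hρ1
  have h0 : (0 : Vec d) ∈ Metric.closedBall 0 ρ := Metric.mem_closedBall_self hρ0
  obtain ⟨w, hw, hmin⟩ := (isCompact_closedBall (0 : Vec d) ρ).exists_isMinOn ⟨0, h0⟩
    fun w hw => (continuousAt_barycenterPotential (r := r) hx.1 (hsub hw)).continuousWithinAt
  have hlt : w ∈ Metric.ball 0 ρ := by
    rw [mem_ball_zero_iff]
    refine lt_of_not_ge fun hge => (hρ w (hsub hw) hge).not_ge ?_
    exact barycenterPotential_zero (r := r) hx.1 ▸ hmin h0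
  exact ⟨w, hsub hw, sum_smul_shift_eq_zero_of_isLocalMin hx.1 (hsub hw) <| hmin.isLocalMin <|
    mem_of_superset (Metric.isOpen_ball.mem_nhds hlt) Metric.ball_subset_closedBall⟩

theorem existsUnique_isConformalBarycenter (hn : 3 ≤ n) (hr : ∀ i, 0 < r i)
    (hr2 : ∀ j, r j < (1 / 2) * ∑ i, r i) (hx : x ∈ ArmX d n) :
    ∃! w, IsConformalBarycenter r x w := by
  have : Nonempty (Fin n) := ⟨⟨0, by lia⟩⟩
  simp only [isConformalBarycenter_iff hx.1]
  obtain ⟨w, hw, h⟩ := exists_sum_smul_shift_eq_zero hr hr2 hx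
  exact ⟨w, ⟨hw, h⟩, fun w' h' => eq_of_sum_smul_shift_eq_zero hn hr hx h'.1 hw h'.2 h⟩

theorem conformalBarycenter_spec (hn : 3 ≤ n) (hr : ∀ i, 0 < r i)
    (hr2 : ∀ j, r j < (1 / 2) * ∑ i, r i) (hx : x ∈ ArmX d n) :
    conformalBarycenter r x ∈ unitBall d ∧
      ∑ i, r i • shift (conformalBarycenter r x) (x i) = 0 := by
  have h := (existsUnique_isConformalBarycenter hn hr hr2 hx).exists
  rw [← isConformalBarycenter_iff hx.1, conformalBarycenter, dif_pos h]
  exact h.choose_spec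

theorem conformalBarycenter_eq (hn : 3 ≤ n) (hr : ∀ i, 0 < r i)
    (hr2 : ∀ j, r j < (1 / 2) * ∑ i, r i) (hx : x ∈ ArmX d n)
    (hw : w ∈ unitBall d) (h : ∑ i, r i • shift w (x i) = 0) : conformalBarycenter r x = w :=
  have hspec := conformalBarycenter_spec hn hr hr2 hx
  eq_of_sum_smul_shift_eq_zero hn hr hx hspec.1 hw hspec.2 h

end Barycenter

section ProjectionSum

variable {ι E : Type*} [Fintype ι] [NormedAddCommGroup E] [InnerProductSpace ℝ E]

/-- The operator `∑ cᵢ (id - yᵢ yᵢᵀ)`, whose matrix on `ℝᵈ` is `projSum c y`. -/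
def projOp (c : ι → ℝ) (y : ι → E) : E →ₗ[ℝ] E :=
  ∑ i, c i • (LinearMap.id - (innerₛₗ ℝ (y i)).smulRight (y i))

theorem projOp_apply (c : ι → ℝ) (y : ι → E) (u : E) :
    projOp c y u = ∑ i, c i • (u - inner ℝ (y i) u • y i) := by
  simp [projOp, LinearMap.sum_apply]

theorem inner_projOp_self (c : ι → ℝ) (y : ι → E) (u : E) :
    inner ℝ (projOp c y u) u = ∑ i, c i * (‖u‖ ^ 2 - inner ℝ (y i) u ^ 2) := by
  rw [projOp_apply, sum_inner]
  refine Finset.sum_congr rfl fun i _ => ?_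
  rw [real_inner_smul_left, inner_sub_left, real_inner_smul_left, real_inner_self_eq_norm_sq]
  ring

variable {d n : ℕ} {y : Fin n → Vec d} {c : Fin n → ℝ}

theorem projOp_injective (hn : 3 ≤ n) (hy : y ∈ ArmX d n) (hc : ∀ i, 0 < c i) :
    Function.Injective (projOp c y) := by
  refine (injective_iff_map_eq_zero _).2 fun u hu => by_contra fun hne => ?_
  have hpos := sum_norm_sq_sub_inner_sq_pos hn hy hc hne
  rw [← inner_projOp_self, hu, inner_zero_left] at hpos
  exact lt_irrefl _ hpos

theorem projOp_surjective (hn : 3 ≤ n) (hy : y ∈ ArmX d n) (hc : ∀ i, 0 < c i) :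
    Function.Surjective (projOp c y) :=
  LinearMap.injective_iff_surjective.1 (projOp_injective hn hy hc)

end ProjectionSum

/-! ### The differential of the shift map along the sphere -/

section SphereShift

variable {d : ℕ} {u v w y z : Vec d}

/-- The restriction of `shift (-w)` to the unit sphere, written as the inversion in a sphere with
centre `-w` followed by a translation. This extension to a neighbourhood of the sphere is easier to
differentiate than `shift` itself. -/
def sphereShift (w z : Vec d) : Vec d := ((1 - ‖w‖ ^ 2) / ‖z + w‖ ^ 2) • (z + w) + w

theorem sphereShift_eq_shift (hw : w ∈ unitBall d) (hz : ‖z‖ = 1) :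
    sphereShift w z = shift (-w) z := by
  rw [shift_eq_of_norm_eq_one (neg_mem_unitBall hw) hz, sphereShift, norm_neg, sub_neg_eq_add,
    sub_neg_eq_add]

theorem sphereShift_neg_eq_shift (hw : w ∈ unitBall d) (hz : ‖z‖ = 1) :
    sphereShift (-w) z = shift w z := by
  rw [sphereShift_eq_shift (neg_mem_unitBall hw) hz, neg_neg]

theorem norm_add_sq_pos (hw : w ∈ unitBall d) (hz : ‖z‖ = 1) : 0 < ‖z + w‖ ^ 2 := by
  simpa using norm_sub_sq_pos (neg_mem_unitBall hw) hz

theorem contDiffAt_sphereShift {m : WithTop ℕ∞} (hw : w ∈ unitBall d) (hz : ‖z‖ = 1) :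
    ContDiffAt ℝ m (fun p : Vec d × Vec d => sphereShift p.1 p.2) (w, z) := by
  have hpole := (norm_add_sq_pos hw hz).ne'
  have hsum : ContDiffAt ℝ m (fun p : Vec d × Vec d => p.2 + p.1) (w, z) := by fun_prop
  have hcoeff := (contDiffAt_const (c := (1 : ℝ)).sub (contDiffAt_fst.norm_sq ℝ)).div
    (hsum.norm_sq ℝ) hpole
  exact (hcoeff.smul hsum).add contDiffAt_fst

theorem hasFDerivAt_sphereShift (hw : w ∈ unitBall d) (hz : ‖z‖ = 1) :
    HasFDerivAt (fun p : Vec d × Vec d => sphereShift p.1 p.2)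
      (fderiv ℝ (fun p : Vec d × Vec d => sphereShift p.1 p.2) (w, z)) (w, z) :=
  ((contDiffAt_sphereShift hw hz).differentiableAt one_ne_zero).hasFDerivAt

theorem fderiv_sphereShift (hw : w ∈ unitBall d) (hz : ‖z‖ = 1) (u v : Vec d) :
    fderiv ℝ (fun p : Vec d × Vec d => sphereShift p.1 p.2) (w, z) (u, v) =
      ((1 - ‖w‖ ^ 2) / ‖z + w‖ ^ 2) • (v + u) -
        (2 * inner ℝ w u / ‖z + w‖ ^ 2 +
          (1 - ‖w‖ ^ 2) * (2 * inner ℝ (z + w) (v + u)) / (‖z + w‖ ^ 2) ^ 2) • (z + w) + u := by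
  have hpole := (norm_add_sq_pos hw hz).ne'
  have hfst := hasFDerivAt_fst (𝕜 := ℝ) (p := (w, z))
  have hsum := hasFDerivAt_snd.add hfst
  have h := (((hfst.norm_sq.const_sub 1).mul
    ((hasDerivAt_inv hpole).comp_hasFDerivAt (w, z) hsum.norm_sq)).smul hsum).add hfst
  rw [show fderiv ℝ (fun p : Vec d × Vec d => sphereShift p.1 p.2) (w, z) = _ from h.fderiv]
  simp only [add_apply, smul_apply, neg_apply, ContinuousLinearMap.smulRight_apply,
    ContinuousLinearMap.comp_apply, ContinuousLinearMap.coe_fst', ContinuousLinearMap.coe_snd',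
    innerSL_apply_apply, Pi.add_apply, Pi.mul_apply, Function.comp_apply, nsmul_eq_mul,
    smul_eq_mul, Nat.cast_ofNat]
  generalize ‖z + w‖ ^ 2 = D at hpole ⊢
  match_scalars <;> field_simp <;> ring

theorem fderiv_sphereShift_left (hw : w ∈ unitBall d) (hz : ‖z‖ = 1) (u : Vec d) :
    fderiv ℝ (fun p : Vec d × Vec d => sphereShift p.1 p.2) (w, z) (u, 0) =
      (2 / (1 - ‖w‖ ^ 2)) • ((u - inner ℝ (sphereShift w z) u • sphereShift w z) -
        (inner ℝ w (sphereShift w z) • u - inner ℝ u (sphereShift w z) • w)) := by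
  have hpole := (norm_add_sq_pos hw hz).ne'
  have hball := (one_sub_norm_sq_pos hw).ne'
  have hinner : inner ℝ u (sphereShift w z) =
      (1 - ‖w‖ ^ 2) / ‖z + w‖ ^ 2 * inner ℝ (z + w) u + inner ℝ w u := by
    rw [sphereShift, inner_add_right, real_inner_smul_right, real_inner_comm, real_inner_comm w u]
  have hsum : inner ℝ (z + w) w = (‖z + w‖ ^ 2 - (1 - ‖w‖ ^ 2)) / 2 := by
    rw [norm_add_sq_real, hz, inner_add_left, real_inner_self_eq_norm_sq]
    ring
  have hcentre : inner ℝ w (sphereShift w z) =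
      (1 - ‖w‖ ^ 2) / ‖z + w‖ ^ 2 * ((‖z + w‖ ^ 2 - (1 - ‖w‖ ^ 2)) / 2) + ‖w‖ ^ 2 := by
    rw [sphereShift, inner_add_right, real_inner_smul_right, real_inner_comm, hsum,
      real_inner_self_eq_norm_sq]
  rw [fderiv_sphereShift hw hz, real_inner_comm u (sphereShift w z), hinner, hcentre, sphereShift,
    zero_add]
  generalize ‖z + w‖ ^ 2 = D at hpole ⊢
  match_scalars <;> field_simp <;> ring

theorem fderiv_sphereShift_of_inner_eq_zero (hw : w ∈ unitBall d) (hy : ‖y‖ = 1)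
    (hv : inner ℝ y v = 0) {x : Vec d}
    (hx : x = v + (2 / (1 - ‖w‖ ^ 2)) • ((u - inner ℝ y u • y) +
        (inner ℝ y w • u - inner ℝ y u • w))) :
    fderiv ℝ (fun p : Vec d × Vec d => sphereShift p.1 p.2) (w, y) (u, v) =
      ((1 - ‖w‖ ^ 2) / ‖y + w‖ ^ 2) • (x - (2 * inner ℝ (y + w) x / ‖y + w‖ ^ 2) • (y + w)) := by
  have hpole := (norm_add_sq_pos hw hy).ne'
  have hball := (one_sub_norm_sq_pos hw).ne'
  have hsum : ‖y + w‖ ^ 2 = 1 + 2 * inner ℝ y w + ‖w‖ ^ 2 := by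
    rw [norm_add_sq_real, hy, one_pow]
  rw [fderiv_sphereShift hw hy, hx]
  simp only [inner_add_left, inner_add_right, inner_sub_right, inner_smul_right,
    real_inner_self_eq_norm_sq, hv, hy, real_inner_comm y w]
  rw [hsum] at hpole ⊢
  match_scalars <;> field_simp <;> ring

end SphereShift

/-! ### Regular level sets and their tangent spaces -/

section RegularLevelSet

open Filter Topology

variable {E F : Type*} [NormedAddCommGroup E] [NormedSpace ℝ E] [NormedAddCommGroup F]
  [NormedSpace ℝ F] {M U : Set E} {p : E}

theorem IsSmoothSubmanifold.of_regular [FiniteDimensional ℝ F] {k : ℕ} {Φ : E → F}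
    (hk : k + Module.finrank ℝ F = Module.finrank ℝ E) (hU : IsOpen U) (hΦ : ContDiff ℝ ∞ Φ)
    (hM : M = {q ∈ U | Φ q = 0}) (hreg : ∀ q ∈ M, Function.Surjective (fderiv ℝ Φ q)) :
    IsSmoothSubmanifold M k := by
  let e : F ≃L[ℝ] EuclideanSpace ℝ (Fin (Module.finrank ℝ F)) :=
    ContinuousLinearEquiv.ofFinrankEq (by simp)
  refine ⟨Module.finrank ℝ F, hk, fun p hp => ⟨U, hU, (hM ▸ hp).1, e ∘ Φ,
    (e.contDiff.comp hΦ).contDiffOn, ?_, fun q hq => ?_⟩⟩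
  · rw [hM]
    ext q
    simp only [Set.mem_inter_iff, Set.mem_ofPred_eq, Function.comp_apply,
      map_eq_zero_iff e e.injective]
    tauto
  · rw [e.comp_fderiv]
    exact e.surjective.comp (hreg q hq.1)

theorem fderivWithin_apply_of_mem_tangentSpaceAt {f g : E → F} (hp : p ∈ M)
    (hg : DifferentiableAt ℝ g p) (hfg : Set.EqOn f g M) {v : E} (hv : v ∈ tangentSpaceAt M p) :
    fderivWithin ℝ f M p v = fderiv ℝ g p v := by
  have hfg' : HasFDerivWithinAt f (fderiv ℝ g p) M p :=
    hg.hasFDerivAt.hasFDerivWithinAt.congr hfg (hfg hp)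
  have hf : HasFDerivWithinAt f (fderivWithin ℝ f M p) M p :=
    hfg'.differentiableWithinAt.hasFDerivWithinAt
  refine LinearMap.eqOn_span (f := (fderivWithin ℝ f M p).toLinearMap)
    (g := (fderiv ℝ g p).toLinearMap) ?_ hv
  rintro _ ⟨γ, ε, hε, hγ, hγM, rfl, rfl⟩
  have hnhds : Set.Ioo (-ε) ε ∈ 𝓝 (0 : ℝ) := Ioo_mem_nhds (neg_lt_zero.2 hε) hε
  have hγ' : HasDerivWithinAt γ (deriv γ 0) (Set.Ioo (-ε) ε) 0 :=
    ((hγ.contDiffAt hnhds).differentiableAt (by simp)).hasDerivAt.hasDerivWithinAt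
  exact ((hf.comp_hasDerivWithinAt 0 hγ' hγM).hasDerivAt hnhds).unique
    ((hfg'.comp_hasDerivWithinAt 0 hγ' hγM).hasDerivAt hnhds)

theorem exists_implicit_curve [CompleteSpace F] {H : ℝ × F → F} (hH : ContDiffAt ℝ ω H (0, 0))
    (hinl : (fderiv ℝ H (0, 0)).comp (.inl ℝ ℝ F) = 0)
    (hinr : (fderiv ℝ H (0, 0)).comp (.inr ℝ ℝ F) = .id ℝ F) :
    ∃ a : ℝ → F, ContDiffAt ℝ ω a 0 ∧ a 0 = 0 ∧ HasDerivAt a 0 0 ∧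
      ∀ᶠ t in 𝓝 0, H (t, a t) = H (0, 0) := by
  have hinv : ((fderiv ℝ H (0, 0)).comp (.inr ℝ ℝ F)).IsInvertible := ⟨.refl ℝ F, hinr.symm⟩
  refine ⟨hH.implicitFunction (by simp) hinv, hH.contDiffAt_implicitFunction (by simp) hinv,
    hH.implicitFunction_apply_self (by simp) hinv, ?_,
    hH.eventually_apply_implicitFunction (by simp) hinv⟩
  simpa [hinl] using
    (hH.hasStrictFDerivAt_implicitFunction (by simp) hinv).hasFDerivAt.hasDerivAt

/-- A velocity `v` in the kernel is realised by the curve `p + t v + S a(t)`, where `S` is a right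
inverse of the derivative and `a` is the implicit function that keeps the curve in the level
set. -/
theorem exists_curve_of_mem_ker_fderiv [FiniteDimensional ℝ F] {Φ : E → F}
    (hΦ : ContDiffAt ℝ ω Φ p) (hreg : Function.Surjective (fderiv ℝ Φ p)) {v : E}
    (hv : fderiv ℝ Φ p v = 0) :
    ∃ γ : ℝ → E, ContDiffAt ℝ ω γ 0 ∧ γ 0 = p ∧ HasDerivAt γ v 0 ∧
      ∀ᶠ t in 𝓝 0, Φ (γ t) = Φ p := by
  have := FiniteDimensional.complete ℝ F
  obtain ⟨S, hS⟩ := (fderiv ℝ Φ p).exists_rightInverse_of_surjective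
    (LinearMap.range_eq_top.2 hreg)
  let L : ℝ × F →L[ℝ] E := (ContinuousLinearMap.toSpanSingleton ℝ v).coprod S
  have hL : ∀ q, L q = q.1 • v + S q.2 := fun q => by simp [L]
  have hbase : p + L (0, 0) = p := by simp [hL]
  have hH : ContDiffAt ℝ ω (fun q => Φ (p + L q)) (0, 0) :=
    ContDiffAt.comp (0, 0) (hbase.symm ▸ hΦ) (by fun_prop)
  have hH' : fderiv ℝ (fun q => Φ (p + L q)) (0, 0) = (fderiv ℝ Φ p).comp L := by
    have hΦ' : HasFDerivAt Φ (fderiv ℝ Φ p) (p + L (0, 0)) :=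
      hbase.symm ▸ (hΦ.differentiableAt (by simp)).hasFDerivAt
    exact (hΦ'.comp (0, 0) (L.hasFDerivAt.const_add p)).fderiv
  obtain ⟨a, ha, ha0, ha', hlevel⟩ := exists_implicit_curve hH
    (by rw [hH']; ext; simp [hL, hv]) (by rw [hH', ← hS]; ext; simp [hL])
  refine ⟨fun t => p + L (t, a t), by fun_prop, by simp only [ha0, hbase], ?_, ?_⟩
  · simpa [hL] using (L.hasFDerivAt.comp_hasDerivAt 0 ((hasDerivAt_id 0).prodMk ha')).const_add p
  · simpa only [hbase] using hlevel

theorem tangentSpaceAt_eq_ker_fderiv [FiniteDimensional ℝ F] {Φ : E → F} (hU : IsOpen U)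
    (hM : M = {q ∈ U | Φ q = 0}) (hp : p ∈ M) (hΦ : ContDiffAt ℝ ω Φ p)
    (hreg : Function.Surjective (fderiv ℝ Φ p)) :
    tangentSpaceAt M p = (fderiv ℝ Φ p).ker := by
  refine le_antisymm (fun v hv => ?_) fun v hv => Submodule.subset_span ?_
  · have hzero : Set.EqOn (fun _ => 0) Φ M := fun q hq => (hM ▸ hq).2.symm
    have h := fderivWithin_apply_of_mem_tangentSpaceAt hp (hΦ.differentiableAt (by simp)) hzero hv
    simpa using h.symm
  · obtain ⟨γ, hγ, hγ0, hγ', hlevel⟩ := exists_curve_of_mem_ker_fderiv hΦ hreg hv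
    have hUγ : ∀ᶠ t in 𝓝 0, γ t ∈ U :=
      hγ.continuousAt.eventually_mem (hU.mem_nhds (hγ0.symm ▸ (hM ▸ hp).1))
    obtain ⟨ε, hε, hball⟩ := Metric.eventually_nhds_iff_ball.1
      ((hγ.eventually (by simp)).and (hUγ.and hlevel))
    rw [Real.ball_eq_Ioo, zero_sub, zero_add] at hball
    refine ⟨γ, ε, hε, fun t ht => ((hball t ht).1.of_le le_top).contDiffWithinAt, fun t ht => ?_,
      hγ0, hγ'.deriv⟩
    rw [hM]
    exact ⟨(hball t ht).2.1, (hball t ht).2.2.trans (hM ▸ hp).2⟩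

end RegularLevelSet

section Submanifolds

variable {d n : ℕ} {r : Fin n → ℝ}

theorem finrank_configuration : Module.finrank ℝ (Fin n → Vec d) = n * d := by
  rw [Module.finrank_pi_fintype]
  simp

theorem isOpen_setOf_pairwise_ne : IsOpen {x : Fin n → Vec d | ∀ i j, i ≠ j → x i ≠ x j} := by
  simp only [Set.ofPred_forall]
  exact isOpen_iInter_of_finite fun i => isOpen_iInter_of_finite fun j =>
    isOpen_iInter_of_finite fun _ => isOpen_ne_fun (continuous_apply i) (continuous_apply j)

/-- The defining function of `Arm d n`. -/
def unitConstraint (x : Fin n → Vec d) : Fin n → ℝ := fun i => ‖x i‖ ^ 2 - 1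

/-- The defining function of `ℝᵈ × Pol d r`. -/
def polygonConstraint (r : Fin n → ℝ) (p : Vec d × (Fin n → Vec d)) : (Fin n → ℝ) × Vec d :=
  (unitConstraint p.2, ∑ i, r i • p.2 i)

theorem unitConstraint_eq_zero_iff {x : Fin n → Vec d} : unitConstraint x = 0 ↔ x ∈ Arm d n := by
  simp only [funext_iff, unitConstraint, Pi.zero_apply, sub_eq_zero, Arm, Set.mem_ofPred_eq,
    pow_eq_one_iff_of_nonneg (norm_nonneg _) two_ne_zero]

theorem contDiff_unitConstraint {m : WithTop ℕ∞} :
    ContDiff ℝ m (unitConstraint : (Fin n → Vec d) → Fin n → ℝ) :=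
  contDiff_pi.2 fun i => ((contDiff_apply ℝ (Vec d) i).norm_sq ℝ).sub contDiff_const

theorem contDiff_polygonConstraint {m : WithTop ℕ∞} :
    ContDiff ℝ m (polygonConstraint r : Vec d × (Fin n → Vec d) → _) :=
  (contDiff_unitConstraint.comp contDiff_snd).prodMk (by fun_prop)

theorem fderiv_unitConstraint (x v : Fin n → Vec d) :
    fderiv ℝ unitConstraint x v = fun i => 2 * inner ℝ (x i) (v i) := by
  have h : HasFDerivAt unitConstraint (ContinuousLinearMap.pi fun i =>
      (2 • innerSL ℝ (x i)).comp (ContinuousLinearMap.proj i)) x :=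
    hasFDerivAt_pi.2 fun i => ((hasFDerivAt_apply i x).norm_sq).sub_const 1
  rw [h.fderiv]
  ext i
  simp

theorem fderiv_polygonConstraint (p v : Vec d × (Fin n → Vec d)) :
    fderiv ℝ (polygonConstraint r) p v =
      (fun i => 2 * inner ℝ (p.2 i) (v.2 i), ∑ i, r i • v.2 i) := by
  have hunit : HasFDerivAt (unitConstraint : (Fin n → Vec d) → _) _ p.2 :=
    (contDiff_unitConstraint.differentiable one_ne_zero p.2).hasFDerivAt
  have hsum : HasFDerivAt (fun p : Vec d × (Fin n → Vec d) => ∑ i, r i • p.2 i) _ p :=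
    HasFDerivAt.fun_sum fun i _ => (((ContinuousLinearMap.proj i).comp
      (.snd ℝ (Vec d) (Fin n → Vec d))).hasFDerivAt.fun_const_smul (r i))
  have h : HasFDerivAt (polygonConstraint r) _ p := (hunit.comp p hasFDerivAt_snd).prodMk hsum
  rw [h.fderiv, ← fderiv_unitConstraint]
  simp

theorem surjective_fderiv_unitConstraint {x : Fin n → Vec d} (hx : x ∈ Arm d n) :
    Function.Surjective (fderiv ℝ unitConstraint x) := fun a => by
  refine ⟨fun i => (a i / 2) • x i, ?_⟩
  rw [fderiv_unitConstraint]
  ext i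
  rw [inner_smul_right, real_inner_self_eq_norm_sq, hx i]
  ring

theorem surjective_fderiv_polygonConstraint (hn : 3 ≤ n) (hr : ∀ i, 0 < r i)
    {p : Vec d × (Fin n → Vec d)} (hp : p.2 ∈ ArmX d n) :
    Function.Surjective (fderiv ℝ (polygonConstraint r) p) := by
  rintro ⟨a, b⟩
  obtain ⟨u, hu⟩ := projOp_surjective hn hp hr (b - ∑ i, r i • (a i / 2) • p.2 i)
  rw [projOp_apply] at hu
  refine ⟨(0, fun i => (a i / 2) • p.2 i + (u - inner ℝ (p.2 i) u • p.2 i)), ?_⟩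
  rw [fderiv_polygonConstraint]
  refine Prod.ext (funext fun i => ?_) ?_
  · simp only [inner_add_right, inner_sub_right, inner_smul_right, real_inner_self_eq_norm_sq,
      hp.1 i]
    ring
  · simp only [smul_add, Finset.sum_add_distrib, hu, add_sub_cancel]

theorem ArmX_eq_setOf_unitConstraint : ArmX d n =
    {x ∈ {x : Fin n → Vec d | ∀ i j, i ≠ j → x i ≠ x j} | unitConstraint x = 0} := by
  ext x
  simp only [ArmX, Set.mem_ofPred_eq, unitConstraint_eq_zero_iff]
  tauto

theorem ball_prod_PolX_eq_setOf_polygonConstraint : unitBall d ×ˢ PolX d r =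
    {p ∈ unitBall d ×ˢ {x : Fin n → Vec d | ∀ i j, i ≠ j → x i ≠ x j} |
      polygonConstraint r p = 0} := by
  ext p
  simp only [PolX, Pol, ArmX, Set.mem_ofPred_eq, Set.mem_prod, Set.mem_inter_iff,
    polygonConstraint, Prod.mk_eq_zero, unitConstraint_eq_zero_iff]
  tauto

theorem isOpen_ball_prod_setOf_pairwise_ne :
    IsOpen (unitBall d ×ˢ {x : Fin n → Vec d | ∀ i j, i ≠ j → x i ≠ x j}) :=
  Metric.isOpen_ball.prod isOpen_setOf_pairwise_ne

theorem isSmoothSubmanifold_ArmX (hd : 1 ≤ d) : IsSmoothSubmanifold (ArmX d n) (n * (d - 1)) := by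
  refine .of_regular ?_ isOpen_setOf_pairwise_ne contDiff_unitConstraint
    ArmX_eq_setOf_unitConstraint fun x hx => surjective_fderiv_unitConstraint hx.1
  rw [finrank_configuration, Module.finrank_fin_fun, ← Nat.mul_succ, Nat.succ_eq_add_one,
    Nat.sub_add_cancel hd]

theorem isSmoothSubmanifold_ball_prod_PolX (hd : 1 ≤ d) (hn : 3 ≤ n) (hr : ∀ i, 0 < r i) :
    IsSmoothSubmanifold (unitBall d ×ˢ PolX d r) (n * (d - 1)) := by
  refine .of_regular ?_ isOpen_ball_prod_setOf_pairwise_ne contDiff_polygonConstraint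
    ball_prod_PolX_eq_setOf_polygonConstraint
    fun p hp => surjective_fderiv_polygonConstraint hn hr hp.2.2
  rw [Module.finrank_prod, Module.finrank_prod, finrank_configuration, Module.finrank_fin_fun,
    finrank_euclideanSpace_fin, ← add_assoc, ← Nat.mul_succ, Nat.succ_eq_add_one,
    Nat.sub_add_cancel hd, add_comm]

theorem mem_tangentSpaceAt_ball_prod_PolX_iff (hn : 3 ≤ n) (hr : ∀ i, 0 < r i)
    {p v : Vec d × (Fin n → Vec d)} (hp : p ∈ unitBall d ×ˢ PolX d r) :
    v ∈ tangentSpaceAt (unitBall d ×ˢ PolX d r) p ↔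
      (∀ i, inner ℝ (p.2 i) (v.2 i) = 0) ∧ ∑ i, r i • v.2 i = 0 := by
  rw [tangentSpaceAt_eq_ker_fderiv isOpen_ball_prod_setOf_pairwise_ne
    ball_prod_PolX_eq_setOf_polygonConstraint hp contDiff_polygonConstraint.contDiffAt
    (surjective_fderiv_polygonConstraint hn hr hp.2.2), LinearMap.mem_ker]
  simp [fderiv_polygonConstraint, funext_iff]

end Submanifolds

/-! ### Smoothness of the opening map and of the closure map -/

section Closure

open Filter Topology

variable {d n : ℕ} {r : Fin n → ℝ} {x : Fin n → Vec d} {w : Vec d}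

theorem SmoothOnSubset.of_contDiffAt {E F : Type*} [NormedAddCommGroup E] [NormedSpace ℝ E]
    [NormedAddCommGroup F] [NormedSpace ℝ F] {f : E → F} {S : Set E}
    (h : ∀ p ∈ S, ∃ g : E → F, ContDiffAt ℝ ω g p ∧ ∀ᶠ q in 𝓝 p, q ∈ S → g q = f q) :
    SmoothOnSubset f S := fun p hp => by
  obtain ⟨g, hg, hgf⟩ := h p hp
  obtain ⟨U, hU, hUo, hpU⟩ := eventually_nhds_iff.1 ((hg.eventually (by simp)).and hgf)
  exact ⟨U, hUo, hpU, g, fun q hq => ((hU q hq).1.of_le le_top).contDiffWithinAt,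
    fun q hq => (hU q hq.2).2 hq.1⟩

theorem SmoothOnSubset.mono {E F : Type*} [NormedAddCommGroup E] [NormedSpace ℝ E]
    [NormedAddCommGroup F] [NormedSpace ℝ F] {f : E → F} {S T : Set E}
    (h : SmoothOnSubset f T) (hST : S ⊆ T) : SmoothOnSubset f S := fun p hp => by
  obtain ⟨U, hU, hpU, g, hg, hgf⟩ := h p (hST hp)
  exact ⟨U, hU, hpU, g, hg, hgf.mono (Set.inter_subset_inter_left U hST)⟩

/-- The equation of the conformal barycenter, extended smoothly from the sphere. -/
def barycenterEq (r : Fin n → ℝ) (p : (Fin n → Vec d) × Vec d) : Vec d :=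
  ∑ i, r i • sphereShift (-p.2) (p.1 i)

theorem barycenterEq_of_mem_Arm (hx : x ∈ Arm d n) (hw : w ∈ unitBall d) :
    barycenterEq r (x, w) = ∑ i, r i • shift w (x i) :=
  Finset.sum_congr rfl fun i _ => by rw [sphereShift_neg_eq_shift hw (hx i)]

theorem contDiffAt_sphereShift_neg {m : WithTop ℕ∞} (hx : x ∈ Arm d n) (hw : w ∈ unitBall d)
    (i : Fin n) :
    ContDiffAt ℝ m (fun p : (Fin n → Vec d) × Vec d => sphereShift (-p.2) (p.1 i)) (x, w) :=
  ContDiffAt.comp (x, w) (f := fun p : (Fin n → Vec d) × Vec d => (-p.2, p.1 i))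
    (contDiffAt_sphereShift (neg_mem_unitBall hw) (hx i)) (by fun_prop)

theorem contDiffAt_barycenterEq {m : WithTop ℕ∞} (hx : x ∈ Arm d n) (hw : w ∈ unitBall d) :
    ContDiffAt ℝ m (barycenterEq r) (x, w) :=
  ContDiffAt.sum fun i _ => (contDiffAt_sphereShift_neg hx hw i).const_smul (r i)

theorem fderiv_barycenterEq_inr (hx : x ∈ Arm d n) (hw : w ∈ unitBall d)
    (h : ∑ i, r i • shift w (x i) = 0) (u : Vec d) :
    fderiv ℝ (barycenterEq r) (x, w) (0, u) =
      -(2 / (1 - ‖w‖ ^ 2)) • projOp r (fun i => shift w (x i)) u := by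
  let L (i : Fin n) : (Fin n → Vec d) × Vec d →L[ℝ] Vec d × Vec d :=
    (-ContinuousLinearMap.snd ℝ (Fin n → Vec d) (Vec d)).prod
      ((ContinuousLinearMap.proj i).comp (ContinuousLinearMap.fst ℝ (Fin n → Vec d) (Vec d)))
  have hcomp : ∀ i ∈ Finset.univ,
      HasFDerivAt (fun p : (Fin n → Vec d) × Vec d => r i • sphereShift (-p.2) (p.1 i))
        (r i • (fderiv ℝ (fun p : Vec d × Vec d => sphereShift p.1 p.2) (-w, x i)).comp (L i))
        (x, w) := fun i _ =>
    (HasFDerivAt.comp (x, w) (f := L i) (g := fun p : Vec d × Vec d => sphereShift p.1 p.2)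
      (hasFDerivAt_sphereShift (neg_mem_unitBall hw) (hx i)) (L i).hasFDerivAt).const_smul (r i)
  have hsum : HasFDerivAt (barycenterEq r) _ (x, w) := HasFDerivAt.fun_sum hcomp
  have hterm : ∀ i, r i • fderiv ℝ (fun p : Vec d × Vec d => sphereShift p.1 p.2) (-w, x i)
      (-u, 0) = -(2 / (1 - ‖w‖ ^ 2)) • (r i • (u - inner ℝ (shift w (x i)) u • shift w (x i))) +
        -(2 / (1 - ‖w‖ ^ 2)) • ((r i * inner ℝ (shift w (x i)) w) • u -
          (r i * inner ℝ (shift w (x i)) u) • w) := fun i => by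
    rw [fderiv_sphereShift_left (neg_mem_unitBall hw) (hx i), sphereShift_neg_eq_shift hw (hx i),
      norm_neg, inner_neg_left, inner_neg_left, inner_neg_right, real_inner_comm w,
      real_inner_comm u]
    module
  calc fderiv ℝ (barycenterEq r) (x, w) (0, u)
      = ∑ i, r i • fderiv ℝ (fun p : Vec d × Vec d => sphereShift p.1 p.2) (-w, x i) (-u, 0) := by
        rw [hsum.fderiv]
        simp [L]
    _ = _ := by
        simp only [hterm, Finset.sum_add_distrib, ← Finset.smul_sum, Finset.sum_sub_distrib,
          ← Finset.sum_smul, sum_mul_inner_eq_zero h, projOp_apply]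
        simp

theorem exists_local_barycenter (hn : 3 ≤ n) (hr : ∀ i, 0 < r i) (hx : x ∈ ArmX d n)
    (hw : w ∈ unitBall d) (h : ∑ i, r i • shift w (x i) = 0) :
    ∃ β : (Fin n → Vec d) → Vec d, ContDiffAt ℝ ω β x ∧ β x = w ∧
      ∀ᶠ z in 𝓝 x, barycenterEq r (z, β z) = 0 := by
  have hsmooth : ContDiffAt ℝ ω (barycenterEq r) (x, w) := contDiffAt_barycenterEq hx.1 hw
  let A := (fderiv ℝ (barycenterEq r) (x, w)).comp (.inr ℝ (Fin n → Vec d) (Vec d))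
  have hA : ∀ u, A u = -(2 / (1 - ‖w‖ ^ 2)) • projOp r (fun i => shift w (x i)) u :=
    fderiv_barycenterEq_inr hx.1 hw h
  have hscale : -(2 / (1 - ‖w‖ ^ 2)) ≠ 0 :=
    neg_ne_zero.2 (div_ne_zero two_ne_zero (one_sub_norm_sq_pos hw).ne')
  have hAinj : Function.Injective A := fun a b hab => by
    rw [hA, hA] at hab
    exact projOp_injective hn (shift_mem_ArmX hw hx) hr (smul_right_injective _ hscale hab)
  have hAinv : A.IsInvertible :=
    ⟨(LinearEquiv.ofInjectiveEndo (A : Vec d →ₗ[ℝ] Vec d) hAinj).toContinuousLinearEquiv, rfl⟩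
  have hzero : barycenterEq r (x, w) = 0 := by rw [barycenterEq_of_mem_Arm hx.1 hw, h]
  refine ⟨hsmooth.implicitFunction (by simp) hAinv,
    hsmooth.contDiffAt_implicitFunction (by simp) hAinv,
    hsmooth.implicitFunction_apply_self (by simp) hAinv, ?_⟩
  simpa only [hzero] using hsmooth.eventually_apply_implicitFunction (by simp) hAinv

theorem smoothOnSubset_closureMap (hn : 3 ≤ n) (hr : ∀ i, 0 < r i)
    (hr2 : ∀ j, r j < (1 / 2) * ∑ i, r i) : SmoothOnSubset (closureMap r) (ArmX d n) := by
  refine .of_contDiffAt fun x hx => ?_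
  obtain ⟨hw, h⟩ := conformalBarycenter_spec hn hr hr2 hx
  obtain ⟨β, hβ, hβx, hβ0⟩ := exists_local_barycenter hn hr hx hw h
  rw [← hβx] at hw
  refine ⟨fun z => (β z, fun i => sphereShift (-β z) (z i)), hβ.prodMk (contDiffAt_pi.2 fun i =>
    ContDiffAt.comp x (f := fun z => (z, β z)) (contDiffAt_sphereShift_neg hx.1 hw i)
      (contDiffAt_id.prodMk hβ)), ?_⟩
  filter_upwards [hβ0, hβ.continuousAt.eventually_mem (Metric.isOpen_ball.mem_nhds hw)]
    with z hz0 hzw hz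
  rw [barycenterEq_of_mem_Arm hz.1 hzw] at hz0
  rw [closureMap, conformalBarycenter_eq hn hr hr2 hz hzw hz0]
  exact Prod.ext rfl (funext fun i => sphereShift_neg_eq_shift hzw (hz.1 i))

theorem contDiffAt_sphereShift_pi {m : WithTop ℕ∞} (hw : w ∈ unitBall d) (hx : x ∈ Arm d n) :
    ContDiffAt ℝ m (fun p : Vec d × (Fin n → Vec d) => fun i => sphereShift p.1 (p.2 i)) (w, x) :=
  contDiffAt_pi.2 fun i => ContDiffAt.comp (w, x)
    (f := fun p : Vec d × (Fin n → Vec d) => (p.1, p.2 i)) (contDiffAt_sphereShift hw (hx i))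
    (by fun_prop)

theorem opening_eqOn_sphereShift :
    Set.EqOn opening (fun p : Vec d × (Fin n → Vec d) => fun i => sphereShift p.1 (p.2 i))
      (unitBall d ×ˢ Arm d n) :=
  fun _ hp => funext fun i => (sphereShift_eq_shift hp.1 (hp.2 i)).symm

theorem smoothOnSubset_opening : SmoothOnSubset opening (unitBall d ×ˢ Arm d n) :=
  .of_contDiffAt fun _ hp => ⟨_, contDiffAt_sphereShift_pi hp.1 hp.2,
    .of_forall fun _ hq => (opening_eqOn_sphereShift hq).symm⟩

theorem isDiffeomorphism_opening (hn : 3 ≤ n) (hr : ∀ i, 0 < r i)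
    (hr2 : ∀ j, r j < (1 / 2) * ∑ i, r i) :
    IsDiffeomorphismWithInverse opening (closureMap r) (unitBall d ×ˢ PolX d r) (ArmX d n) where
  mapsTo := fun _ hp => shift_mem_ArmX (neg_mem_unitBall hp.1) hp.2.2
  mapsTo_inv := fun x hx => by
    obtain ⟨hw, h⟩ := conformalBarycenter_spec hn hr hr2 hx
    have hmem := shift_mem_ArmX hw hx
    exact ⟨hw, ⟨hmem.1, h⟩, hmem⟩
  leftInv := by
    rintro ⟨w, y⟩ ⟨hw, hy⟩
    have hinv : ∀ i, shift w (opening (w, y) i) = y i := fun i => shift_shift_neg hw (hy.2.1 i).le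
    have hbary : conformalBarycenter r (opening (w, y)) = w :=
      conformalBarycenter_eq hn hr hr2 (shift_mem_ArmX (neg_mem_unitBall hw) hy.2) hw
        (by simpa only [hinv] using hy.1.2)
    simp only [closureMap, hbary, hinv]
  rightInv := fun x hx => funext fun i =>
    shift_neg_shift (conformalBarycenter_spec hn hr hr2 hx).1 (hx.1 i).le
  smooth := smoothOnSubset_opening.mono (Set.prod_mono_right fun _ hy => hy.2.1)
  smooth_inv := smoothOnSubset_closureMap hn hr hr2

end Closure

/-! ### Determinants of pulled back forms -/

section AbstractJacobian

open LinearMap (BilinForm)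
open Module

theorem det_prod_triangular {R U K : Type*} [CommRing R] [AddCommGroup U] [Module R U]
    [Module.Free R U] [Module.Finite R U] [AddCommGroup K] [Module R K] [Module.Free R K]
    [Module.Finite R K] (B : U →ₗ[R] U) (L : U →ₗ[R] K) :
    LinearMap.det ((B ∘ₗ .fst R U K).prod (L ∘ₗ .fst R U K + .snd R U K)) =
      LinearMap.det B := by
  classical
  let b := Free.chooseBasis R U
  let b' := Free.chooseBasis R K
  have hblocks : LinearMap.toMatrix (b.prod b') (b.prod b')
      ((B ∘ₗ .fst R U K).prod (L ∘ₗ .fst R U K + .snd R U K)) =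
      Matrix.fromBlocks (LinearMap.toMatrix b b B) 0 (LinearMap.toMatrix b b' L) 1 := by
    ext (i | i) (j | j) <;> simp [LinearMap.toMatrix_apply, Matrix.one_apply, Finsupp.single_apply,
      eq_comm]
  rw [← LinearMap.det_toMatrix (b.prod b'), hblocks, Matrix.det_fromBlocks_zero₁₂, Matrix.det_one,
    mul_one, LinearMap.det_toMatrix]

theorem det_pi_smul {𝕜 ι : Type*} [Field 𝕜] [Fintype ι] {M : ι → Type*} [∀ i, AddCommGroup (M i)]
    [∀ i, Module 𝕜 (M i)] [∀ i, FiniteDimensional 𝕜 (M i)] {k : ℕ}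
    (hk : ∀ i, finrank 𝕜 (M i) = k) (l : ι → 𝕜) :
    LinearMap.det (LinearMap.pi fun i => l i • LinearMap.proj (R := 𝕜) (φ := M) i) =
      (∏ i, l i) ^ k := by
  let e : (∀ i, M i) ≃ₗ[𝕜] (ι → Fin k → 𝕜) := LinearEquiv.piCongrRight fun i =>
    LinearEquiv.ofFinrankEq (M i) (Fin k → 𝕜) (by simp [hk i])
  have hconj : (e.toLinearMap ∘ₗ (LinearMap.pi fun i => l i • LinearMap.proj (R := 𝕜) (φ := M) i) ∘ₗ
      e.symm.toLinearMap) = LinearMap.pi (fun i => (l i • LinearMap.id).comp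
        (LinearMap.proj (R := 𝕜) (φ := fun _ => Fin k → 𝕜) i)) := by
    ext1 x
    funext i
    simp [e]
  rw [← LinearMap.det_conj _ e, hconj, LinearMap.det_pi, ← Finset.prod_pow]
  exact Finset.prod_congr rfl fun i _ => by simp

section Field

variable {𝕜 U V K T : Type*} [Field 𝕜] [AddCommGroup U] [Module 𝕜 U] [AddCommGroup V] [Module 𝕜 V]
  [AddCommGroup K] [Module 𝕜 K] [AddCommGroup T] [Module 𝕜 T] [FiniteDimensional 𝕜 T]

theorem det_eq_det_mul_det_of_nondegenerate {g : BilinForm 𝕜 T} (hg : g.Nondegenerate)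
    {Z P Q : T →ₗ[𝕜] T} (h : ∀ x y, g (Z x) y = g (P x) (Q y)) :
    LinearMap.det Z = LinearMap.det P * LinearMap.det Q := by
  classical
  let b := Free.chooseBasis 𝕜 T
  have hdet : (LinearMap.BilinForm.toMatrix b g).det ≠ 0 :=
    (BilinForm.nondegenerate_iff_det_ne_zero b).1 hg
  have hforms :
      LinearMap.BilinForm.toMatrix b (g.compLeft Z) = LinearMap.BilinForm.toMatrix b (g.comp P Q) :=
    congrArg _ (LinearMap.ext₂ h)
  have hdets := congrArg Matrix.det hforms
  simp only [LinearMap.BilinForm.toMatrix_compLeft, LinearMap.BilinForm.toMatrix_comp b b,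
    Matrix.det_mul, Matrix.det_transpose, LinearMap.det_toMatrix] at hdets
  exact mul_right_cancel₀ hdet (hdets.trans (mul_right_comm _ _ _))

/-- The orthogonal sum of two bilinear forms. -/
def prodForm (g : BilinForm 𝕜 U) (h : BilinForm 𝕜 K) : BilinForm 𝕜 (U × K) :=
  g.comp (.fst 𝕜 U K) (.fst 𝕜 U K) + h.comp (.snd 𝕜 U K) (.snd 𝕜 U K)

theorem prodForm_apply (g : BilinForm 𝕜 U) (h : BilinForm 𝕜 K) (p q : U × K) :
    prodForm g h p q = g p.1 q.1 + h p.2 q.2 := rfl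

theorem prodForm_nondegenerate {g : BilinForm 𝕜 U} {h : BilinForm 𝕜 K} (hg : g.Nondegenerate)
    (hh : h.Nondegenerate) : (prodForm g h).Nondegenerate :=
  ⟨fun p hp => Prod.ext
      (hg.1 p.1 fun u => by simpa [prodForm_apply] using hp (u, 0))
      (hh.1 p.2 fun v => by simpa [prodForm_apply] using hp (0, v)),
    fun p hp => Prod.ext
      (hg.2 p.1 fun u => by simpa [prodForm_apply] using hp (u, 0))
      (hh.2 p.2 fun v => by simpa [prodForm_apply] using hp (0, v))⟩

variable [FiniteDimensional 𝕜 U]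

theorem bijective_coprod_subtype_ker {c : V →ₗ[𝕜] U} {s : U →ₗ[𝕜] V}
    (h : Function.Injective (c ∘ₗ s)) :
    Function.Bijective (s.coprod (LinearMap.ker c).subtype) := by
  refine ⟨(injective_iff_map_eq_zero _).2 fun p hp => ?_, fun x => ?_⟩
  · rw [LinearMap.coprod_apply] at hp
    have hfst : p.1 = 0 := h (by simpa using congrArg c hp)
    exact Prod.ext hfst (by simpa [hfst] using hp)
  · obtain ⟨u, hu⟩ := LinearMap.injective_iff_surjective.1 h (c x)
    rw [LinearMap.comp_apply] at hu
    exact ⟨(u, ⟨x - s u, by simp [hu]⟩), by simp⟩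

variable [FiniteDimensional 𝕜 V]

theorem det_comp_mul_det_of_coprod_comp_eq {c : V →ₗ[𝕜] U} {s A : U →ₗ[𝕜] V}
    (h : Function.Injective (c ∘ₗ s)) {Q : (U × LinearMap.ker c) →ₗ[𝕜] (U × LinearMap.ker c)}
    (hQ : s.coprod (LinearMap.ker c).subtype ∘ₗ Q = A.coprod (LinearMap.ker c).subtype) :
    LinearMap.det (c ∘ₗ s) * LinearMap.det Q = LinearMap.det (c ∘ₗ A) := by
  have hQ' : ∀ p, s (Q p).1 + (Q p).2 = A p.1 + p.2 := LinearMap.congr_fun hQ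
  have hcQ : ∀ p, c (s (Q p).1) = c (A p.1) := fun p => by simpa using congrArg c (hQ' p)
  have hQker : ∀ v, Q (0, v) = (0, v) := fun v =>
    (bijective_coprod_subtype_ker h).1 (by simpa using hQ' (0, v))
  let L : U →ₗ[𝕜] LinearMap.ker c := .snd 𝕜 U _ ∘ₗ Q ∘ₗ .inl 𝕜 U _
  have htriangular : (c ∘ₗ s).prodMap LinearMap.id ∘ₗ Q =
      ((c ∘ₗ A) ∘ₗ .fst 𝕜 U _).prod (L ∘ₗ .fst 𝕜 U _ + .snd 𝕜 U _) :=
    LinearMap.ext fun p => Prod.ext (hcQ p) <| by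
      have hsplit : Q p = Q (p.1, 0) + (0, p.2) := by rw [← hQker, ← map_add]; simp
      simp [hsplit, L]
  rw [← det_prod_triangular (c ∘ₗ A) L, ← htriangular, LinearMap.det_comp, LinearMap.det_prodMap,
    LinearMap.det_id, mul_one]

/- Splitting `V` orthogonally as `range cs ⊕ ker c` makes the map `(u, v) ↦ A u + v`, and with it
the Gram determinant, block triangular. -/
theorem det_gram_of_ker {gU : BilinForm 𝕜 U} {gV : BilinForm 𝕜 V} {c : V →ₗ[𝕜] U}
    {cs A : U →ₗ[𝕜] V} {X : V →ₗ[𝕜] V} {Z : (U × LinearMap.ker c) →ₗ[𝕜] (U × LinearMap.ker c)}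
    (hU : gU.Nondegenerate) (hker : (gV.restrict (LinearMap.ker c)).Nondegenerate)
    (hV : ∀ v v', gV v v' = gV v' v) (hcs : ∀ u v, gV (cs u) v = gU u (c v))
    (hinj : Function.Injective (c ∘ₗ cs))
    (hZ : ∀ p q, prodForm gU (gV.restrict (LinearMap.ker c)) (Z p) q =
      gV (X (A p.1 + p.2)) (A q.1 + q.2)) :
    LinearMap.det Z * LinearMap.det (c ∘ₗ cs) = LinearMap.det (c ∘ₗ A) ^ 2 * LinearMap.det X := by
  let E := LinearEquiv.ofBijective _ (bijective_coprod_subtype_ker hinj)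
  have hE : ∀ p, E p = cs p.1 + p.2 := fun p => rfl
  let Q := E.symm.toLinearMap ∘ₗ A.coprod (LinearMap.ker c).subtype
  have hQ : ∀ p, E (Q p) = A p.1 + p.2 := fun p => E.apply_symm_apply _
  let X' := E.symm.toLinearMap ∘ₗ X ∘ₗ E.toLinearMap
  have hX' : ∀ p, E (X' p) = X (E p) := fun p => E.apply_symm_apply _
  let N := (c ∘ₗ cs).prodMap (LinearMap.id (M := LinearMap.ker c))
  have hgram : ∀ p q, gV (E p) (E q) = prodForm gU (gV.restrict (LinearMap.ker c)) p (N q) := by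
    intro p q
    have hpq : gV (p.2 : V) (cs q.1) = 0 := by rw [hV, hcs, p.2.2, map_zero]
    simp [hE, prodForm_apply, N, hcs, hpq]
  have hdetZ := det_eq_det_mul_det_of_nondegenerate (prodForm_nondegenerate hU hker)
    (Z := Z) (P := X' ∘ₗ Q) (Q := N ∘ₗ Q) fun p q => by
      rw [hZ, ← hQ, ← hQ, ← hX', hgram]; rfl
  have hdetX : LinearMap.det X' = LinearMap.det X := LinearMap.det_conj X E.symm
  have hdetQ := det_comp_mul_det_of_coprod_comp_eq hinj (LinearMap.ext hQ)
  rw [hdetZ, LinearMap.det_comp, LinearMap.det_comp, hdetX, LinearMap.det_prodMap,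
    LinearMap.det_id, ← hdetQ]
  ring

end Field

theorem exists_det_eq_det_metricAdjoint_comp {T T' W : Type*} [AddCommGroup T] [Module ℝ T]
    [FiniteDimensional ℝ T] [AddCommGroup T'] [Module ℝ T'] [AddCommGroup W] [Module ℝ W]
    (g : BilinForm ℝ T) (hg : g.Nondegenerate) (h : BilinForm ℝ W) (D : T →ₗ[ℝ] W)
    (e : T' ≃ₗ[ℝ] T) :
    ∃ Z : T' →ₗ[ℝ] T', LinearMap.det (metricAdjoint g hg h D ∘ₗ D) = LinearMap.det Z ∧
      ∀ p q, g (e (Z p)) (e q) = h (D (e p)) (D (e q)) :=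
  ⟨e.symm.toLinearMap ∘ₗ (metricAdjoint g hg h D ∘ₗ D) ∘ₗ e.toLinearMap,
    (LinearMap.det_conj _ e.symm).symm, fun p q => by simp [metricAdjoint_spec]⟩

end AbstractJacobian

section ProjectionDeterminant

variable {d n : ℕ} {y : Fin n → Vec d} {c : Fin n → ℝ}

theorem toEuclideanLin_projSum (c : Fin n → ℝ) (y : Fin n → Vec d) :
    (projSum c y).toEuclideanLin = projOp c y := by
  refine LinearMap.ext fun u => ?_
  rw [projSum, map_sum, LinearMap.sum_apply, projOp_apply]
  refine Finset.sum_congr rfl fun i _ => ?_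
  ext a
  simp [Matrix.mulVec, dotProduct, PiLp.inner_apply, Finset.mul_sum,
    mul_comm, mul_left_comm]

theorem det_projOp (c : Fin n → ℝ) (y : Fin n → Vec d) :
    LinearMap.det (projOp c y) = (projSum c y).det := by
  rw [← toEuclideanLin_projSum, LinearMap.det_toLpLin]

theorem det_projSum_pos (hn : 3 ≤ n) (hy : y ∈ ArmX d n) (hc : ∀ i, 0 < c i) :
    0 < (projSum c y).det := by
  have hsymm : (projOp c y).IsSymmetric := fun u v => by
    simp only [projOp_apply, sum_inner, inner_sum, inner_sub_left, inner_sub_right,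
      real_inner_smul_left, real_inner_smul_right, real_inner_comm u, mul_comm]
  have hnonneg : ∀ u, 0 ≤ inner ℝ (projOp c y u) u := fun u => by
    rcases eq_or_ne u 0 with rfl | hu
    · simp
    · exact (inner_projOp_self c y u).symm ▸ (sum_norm_sq_sub_inner_sq_pos hn hy hc hu).le
  have hpos : (projSum c y).PosSemidef := by
    rw [← Matrix.isPositive_toEuclideanLin_iff, toEuclideanLin_projSum]
    exact ⟨hsymm, hnonneg⟩
  refine hpos.det_nonneg.lt_of_ne' ?_
  rw [← det_projOp, ← isUnit_iff_ne_zero, ← LinearMap.isUnit_iff_isUnit_det,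
    LinearMap.isUnit_iff_ker_eq_bot, LinearMap.ker_eq_bot]
  exact projOp_injective hn hy hc

end ProjectionDeterminant

/-! ### The Jacobian of the opening map -/

section TangentModel

open LinearMap (BilinForm)

theorem inner_sub_smul_sub_smul_eq {E : Type*} [NormedAddCommGroup E] [InnerProductSpace ℝ E]
    {e : E} (he : ‖e‖ ^ 2 ≠ 0) (x x' : E) :
    inner ℝ (x - (2 * inner ℝ e x / ‖e‖ ^ 2) • e) (x' - (2 * inner ℝ e x' / ‖e‖ ^ 2) • e) =
      inner ℝ x x' := by
  simp only [inner_sub_left, inner_sub_right, inner_smul_left, inner_smul_right,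
    real_inner_self_eq_norm_sq, real_inner_comm e x, conj_trivial]
  generalize ‖e‖ ^ 2 = N at *
  field_simp
  ring

theorem nondegenerate_innerₗ (E : Type*) [NormedAddCommGroup E] [InnerProductSpace ℝ E] :
    (innerₗ E).Nondegenerate :=
  ⟨fun u hu => inner_self_eq_zero.1 (hu u), fun u hu => inner_self_eq_zero.1 (hu u)⟩

variable {d n : ℕ} {r ϱ : Fin n → ℝ} {w : Vec d} {y : Fin n → Vec d}

theorem armMetric_apply (u v : Fin n → Vec d) :
    armMetric d ϱ u v = ∑ i, ϱ i ^ 2 * inner ℝ (u i) (v i) := rfl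

/-- The orthogonal projection onto `y^⊥`, which for a unit vector `y` is the tangent space of the
sphere at `y`. -/
def tangentProj (y : Vec d) : Vec d →ₗ[ℝ] (ℝ ∙ y)ᗮ := (ℝ ∙ y)ᗮ.orthogonalProjectionOnto

theorem inner_tangentProj (y u : Vec d) (v : (ℝ ∙ y)ᗮ) :
    inner ℝ (tangentProj y u : Vec d) (v : Vec d) = inner ℝ u (v : Vec d) :=
  Submodule.inner_orthogonalProjectionOnto_eq_of_mem_right v u

theorem coe_tangentProj {y : Vec d} (hy : ‖y‖ = 1) (u : Vec d) :
    (tangentProj y u : Vec d) = u - inner ℝ y u • y := by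
  rw [← Submodule.starProjection_unit_singleton ℝ hy u]
  exact Submodule.starProjection_orthogonal_val _

/-- The tangent vector of the sphere at `y` whose image under the differential of the shift map by
`-w` is that of the displacement `u` of `w`. -/
def centerField (w y : Vec d) : Vec d →ₗ[ℝ] (ℝ ∙ y)ᗮ :=
  (2 / (1 - ‖w‖ ^ 2)) • tangentProj y ∘ₗ
    (LinearMap.id + ((inner ℝ y w : ℝ) • LinearMap.id - (innerₛₗ ℝ y).smulRight w))

theorem coe_centerField {y : Vec d} (hy : ‖y‖ = 1) (w u : Vec d) :
    (centerField w y u : Vec d) = (2 / (1 - ‖w‖ ^ 2)) • ((u - inner ℝ y u • y) +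
      (inner ℝ y w • u - inner ℝ y u • w)) := by
  have hrotation : inner ℝ y (inner ℝ y w • u - inner ℝ y u • w) = 0 := by
    rw [inner_sub_right, inner_smul_right, inner_smul_right, mul_comm, sub_self]
  simp only [centerField, LinearMap.smul_apply, LinearMap.comp_apply, LinearMap.add_apply,
    LinearMap.sub_apply, LinearMap.id_apply, LinearMap.smulRight_apply, innerₛₗ_apply_apply,
    Submodule.coe_smul, coe_tangentProj hy, inner_add_right, hrotation, add_zero]
  module

/-- The tangent space at `y` of the configurations of unit vectors. -/
abbrev ArmTangent (y : Fin n → Vec d) : Type := ∀ i, (ℝ ∙ y i)ᗮ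

/-- The inclusion of the tangent space of the configurations of unit vectors. -/
def armInclusion (y : Fin n → Vec d) : ArmTangent y →ₗ[ℝ] (Fin n → Vec d) :=
  LinearMap.pi fun i => Submodule.subtype _ ∘ₗ LinearMap.proj i

theorem inner_coe_armTangent (v : ArmTangent y) (i : Fin n) : inner ℝ (y i) (v i : Vec d) = 0 :=
  Submodule.mem_orthogonal_singleton_iff_inner_right.1 (v i).2

/-- The restriction of `armMetric` to the tangent space of the configurations of unit vectors. -/
def armTangentMetric (ϱ : Fin n → ℝ) (y : Fin n → Vec d) : BilinForm ℝ (ArmTangent y) :=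
  (armMetric d ϱ).comp (armInclusion y) (armInclusion y)

theorem armTangentMetric_apply (u v : ArmTangent y) :
    armTangentMetric ϱ y u v = ∑ i, ϱ i ^ 2 * inner ℝ (u i : Vec d) (v i : Vec d) := rfl

theorem armTangentMetric_comm (u v : ArmTangent y) :
    armTangentMetric ϱ y u v = armTangentMetric ϱ y v u := by
  simp only [armTangentMetric_apply, real_inner_comm]

theorem armTangentMetric_pos (hϱ : ∀ i, 0 < ϱ i) (v : ArmTangent y) (hv : v ≠ 0) :
    0 < armTangentMetric ϱ y v v := by
  obtain ⟨i, hi⟩ := Function.ne_iff.1 hv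
  refine Finset.sum_pos' (fun i _ => mul_nonneg (sq_nonneg _) real_inner_self_nonneg)
    ⟨i, Finset.mem_univ _, mul_pos (pow_pos (hϱ i) 2) (real_inner_self_pos.2 ?_)⟩
  simpa [armInclusion] using hi

/-- The differential of the closing condition `∑ rᵢ yᵢ = 0`. -/
def closingDifferential (r : Fin n → ℝ) (y : Fin n → Vec d) : ArmTangent y →ₗ[ℝ] Vec d :=
  ∑ i, r i • (Submodule.subtype _ ∘ₗ LinearMap.proj i)

theorem closingDifferential_apply (r : Fin n → ℝ) (v : ArmTangent y) :
    closingDifferential r y v = ∑ i, r i • (v i : Vec d) := by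
  simp [closingDifferential]

/-- The adjoint of `closingDifferential` with respect to `armTangentMetric`. -/
def closingAdjoint (r ϱ : Fin n → ℝ) (y : Fin n → Vec d) : Vec d →ₗ[ℝ] ArmTangent y :=
  LinearMap.pi fun i => (r i / ϱ i ^ 2) • tangentProj (y i)

theorem armTangentMetric_closingAdjoint (hϱ : ∀ i, ϱ i ≠ 0) (u : Vec d) (v : ArmTangent y) :
    armTangentMetric ϱ y (closingAdjoint r ϱ y u) v = inner ℝ u (closingDifferential r y v) := by
  rw [armTangentMetric_apply, closingDifferential_apply, inner_sum]
  refine Finset.sum_congr rfl fun i _ => ?_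
  simp only [closingAdjoint, LinearMap.pi_apply, LinearMap.smul_apply, Submodule.coe_smul,
    real_inner_smul_left, inner_tangentProj, real_inner_smul_right]
  rw [← mul_assoc, mul_div_cancel₀ _ (pow_ne_zero 2 (hϱ i))]

theorem closingDifferential_comp_closingAdjoint (hy : y ∈ Arm d n) :
    closingDifferential r y ∘ₗ closingAdjoint r ϱ y = projOp (fun i => r i ^ 2 / ϱ i ^ 2) y := by
  refine LinearMap.ext fun u => ?_
  rw [LinearMap.comp_apply, closingDifferential_apply, projOp_apply]
  refine Finset.sum_congr rfl fun i _ => ?_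
  simp only [closingAdjoint, LinearMap.pi_apply, LinearMap.smul_apply, Submodule.coe_smul,
    coe_tangentProj (hy i), smul_smul]
  ring_nf

theorem closingDifferential_comp_centerField (hy : y ∈ Pol d r) (w : Vec d) :
    closingDifferential r y ∘ₗ LinearMap.pi (fun i => centerField w (y i)) =
      (2 / (1 - ‖w‖ ^ 2)) • projOp r y := by
  refine LinearMap.ext fun u => ?_
  have hterm : ∀ i, r i • (centerField w (y i) u : Vec d) =
      (2 / (1 - ‖w‖ ^ 2)) • (r i • (u - inner ℝ (y i) u • y i)) +
      (2 / (1 - ‖w‖ ^ 2)) • ((r i * inner ℝ (y i) w) • u - (r i * inner ℝ (y i) u) • w) :=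
    fun i => by
      rw [coe_centerField (hy.1 i)]
      module
  simp only [LinearMap.comp_apply, closingDifferential_apply, LinearMap.smul_apply, projOp_apply,
    LinearMap.pi_apply, hterm, Finset.sum_add_distrib, ← Finset.smul_sum, Finset.sum_sub_distrib,
    ← Finset.sum_smul, sum_mul_inner_eq_zero hy.2, zero_smul, sub_zero, smul_zero, add_zero]

/-- The tangent vectors of `𝔹 × Pol^×` at `(w, y)`, parametrised by a displacement of `w` and an
element of the kernel of `closingDifferential`. -/
def tangentModel (r : Fin n → ℝ) (y : Fin n → Vec d) :
    (Vec d × LinearMap.ker (closingDifferential r y)) →ₗ[ℝ] Vec d × (Fin n → Vec d) :=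
  LinearMap.id.prodMap (armInclusion y ∘ₗ Submodule.subtype _)

theorem tangentModel_injective (r : Fin n → ℝ) (y : Fin n → Vec d) :
    Function.Injective (tangentModel r y) :=
  Function.injective_id.prodMap <| Function.Injective.comp
    (g := armInclusion y) (fun _ _ h => funext fun i => Subtype.ext (congrFun h i))
    Subtype.val_injective

theorem range_tangentModel (hn : 3 ≤ n) (hr : ∀ i, 0 < r i) (hw : w ∈ unitBall d)
    (hy : y ∈ PolX d r) :
    LinearMap.range (tangentModel r y) = tangentSpaceAt (unitBall d ×ˢ PolX d r) (w, y) := by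
  ext p
  rw [mem_tangentSpaceAt_ball_prod_PolX_iff hn hr (Set.mk_mem_prod hw hy)]
  constructor
  · rintro ⟨⟨u, v⟩, rfl⟩
    have hv := v.2
    rw [LinearMap.mem_ker, closingDifferential_apply] at hv
    exact ⟨inner_coe_armTangent v.1, hv⟩
  · rintro ⟨horth, hclosed⟩
    refine ⟨(p.1, ⟨fun i => ⟨p.2 i, Submodule.mem_orthogonal_singleton_iff_inner_right.2 (horth i)⟩,
      ?_⟩), rfl⟩
    rw [LinearMap.mem_ker, closingDifferential_apply]
    exact hclosed

/-- The identification of the tangent space of `𝔹 × Pol^×` with its model. -/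
def tangentEquiv (hn : 3 ≤ n) (hr : ∀ i, 0 < r i) (hw : w ∈ unitBall d) (hy : y ∈ PolX d r) :
    (Vec d × LinearMap.ker (closingDifferential r y)) ≃ₗ[ℝ]
      tangentSpaceAt (unitBall d ×ˢ PolX d r) (w, y) :=
  (LinearEquiv.ofInjective _ (tangentModel_injective r y)).trans
    (LinearEquiv.ofEq _ _ (range_tangentModel hn hr hw hy))

end TangentModel

section Jacobian

open Module

variable {d n : ℕ} {r ϱ : Fin n → ℝ} {w : Vec d} {y : Fin n → Vec d}

theorem fderivWithin_opening (hw : w ∈ unitBall d) (hy : y ∈ PolX d r)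
    {p : Vec d × (Fin n → Vec d)} (hp : p ∈ tangentSpaceAt (unitBall d ×ˢ PolX d r) (w, y))
    (i : Fin n) :
    fderivWithin ℝ opening (unitBall d ×ˢ PolX d r) (w, y) p i =
      fderiv ℝ (fun p : Vec d × Vec d => sphereShift p.1 p.2) (w, y i) (p.1, p.2 i) := by
  let L (i : Fin n) : Vec d × (Fin n → Vec d) →L[ℝ] Vec d × Vec d :=
    (ContinuousLinearMap.fst ℝ (Vec d) (Fin n → Vec d)).prod
      ((ContinuousLinearMap.proj i).comp (ContinuousLinearMap.snd ℝ (Vec d) (Fin n → Vec d)))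
  have hderiv : HasFDerivAt (fun p : Vec d × (Fin n → Vec d) => fun i => sphereShift p.1 (p.2 i))
      (ContinuousLinearMap.pi fun i =>
        (fderiv ℝ (fun p : Vec d × Vec d => sphereShift p.1 p.2) (w, y i)).comp (L i)) (w, y) :=
    hasFDerivAt_pi.2 fun i => HasFDerivAt.comp (w, y) (f := L i)
      (g := fun p : Vec d × Vec d => sphereShift p.1 p.2) (hasFDerivAt_sphereShift hw (hy.2.1 i))
      (L i).hasFDerivAt
  rw [fderivWithin_apply_of_mem_tangentSpaceAt (Set.mk_mem_prod hw hy) hderiv.differentiableAt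
    (opening_eqOn_sphereShift.mono (Set.prod_mono_right fun _ h => h.2.1)) hp, hderiv.fderiv]
  rfl

theorem inner_fderiv_sphereShift {y u v u' v' : Vec d} (hw : w ∈ unitBall d) (hy : ‖y‖ = 1)
    (hv : inner ℝ y v = 0) (hv' : inner ℝ y v' = 0) :
    inner ℝ (fderiv ℝ (fun p : Vec d × Vec d => sphereShift p.1 p.2) (w, y) (u, v))
      (fderiv ℝ (fun p : Vec d × Vec d => sphereShift p.1 p.2) (w, y) (u', v')) =
    ((1 - ‖w‖ ^ 2) / ‖y + w‖ ^ 2) ^ 2 *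
      inner ℝ (centerField w y u + v : Vec d) (centerField w y u' + v' : Vec d) := by
  rw [fderiv_sphereShift_of_inner_eq_zero hw hy hv rfl,
    fderiv_sphereShift_of_inner_eq_zero hw hy hv' rfl, real_inner_smul_left, real_inner_smul_right,
    inner_sub_smul_sub_smul_eq (norm_add_sq_pos hw hy).ne', coe_centerField hy, coe_centerField hy,
    add_comm v, add_comm v']
  ring

/-- The linear map that stretches the `i`-th tangent vector by the square of the conformal factor
of the shift map by `-w` at `yᵢ`. -/
def conformalFactorSq (w : Vec d) (y : Fin n → Vec d) : ArmTangent y →ₗ[ℝ] ArmTangent y :=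
  LinearMap.pi fun i => (((1 - ‖w‖ ^ 2) / ‖y i + w‖ ^ 2) ^ 2) • LinearMap.proj i

theorem armMetric_differentialAlong_opening (hn : 3 ≤ n) (hr : ∀ i, 0 < r i)
    (hw : w ∈ unitBall d) (hy : y ∈ PolX d r)
    (p q : Vec d × LinearMap.ker (closingDifferential r y)) :
    armMetric d ϱ
        (differentialAlong opening (unitBall d ×ˢ PolX d r) (w, y) (tangentEquiv hn hr hw hy p))
        (differentialAlong opening (unitBall d ×ˢ PolX d r) (w, y) (tangentEquiv hn hr hw hy q)) =
      armTangentMetric ϱ y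
        (conformalFactorSq w y (LinearMap.pi (fun i => centerField w (y i)) p.1 + p.2))
        (LinearMap.pi (fun i => centerField w (y i)) q.1 + q.2) := by
  rw [armMetric_apply, armTangentMetric_apply]
  refine Finset.sum_congr rfl fun i _ => congrArg (ϱ i ^ 2 * ·) ?_
  have hfderiv := fun p => fderivWithin_opening hw hy (tangentEquiv hn hr hw hy p).2 i
  refine (congrArg₂ (inner ℝ) (hfderiv p) (hfderiv q)).trans ?_
  refine (inner_fderiv_sphereShift hw (hy.2.1 i) (inner_coe_armTangent p.2.1 i)
    (inner_coe_armTangent q.2.1 i)).trans ?_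
  exact (real_inner_smul_left _ _ _).symm

theorem finrank_orthogonal_of_norm_eq_one {y : Vec d} (hy : ‖y‖ = 1) :
    finrank ℝ (ℝ ∙ y)ᗮ = d - 1 := by
  have hadd := (ℝ ∙ y).finrank_add_finrank_orthogonal
  rw [finrank_span_singleton (norm_ne_zero_iff.1 (hy.symm ▸ one_ne_zero)),
    finrank_euclideanSpace_fin] at hadd
  omega

theorem Jop_eq_sqrt (hn : 3 ≤ n) (hr : ∀ i, 0 < r i) (hϱ : ∀ i, 0 < ϱ i)
    (hw : w ∈ unitBall d) (hy : y ∈ PolX d r) :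
    Jop r ϱ hϱ w y = √((((2 / (1 - ‖w‖ ^ 2)) ^ d * (projSum r y).det) ^ 2 *
      (∏ i, ((1 - ‖w‖ ^ 2) / ‖y i + w‖ ^ 2) ^ 2) ^ (d - 1)) /
        (projSum (fun i => r i ^ 2 / ϱ i ^ 2) y).det) := by
  have hc : ∀ i, 0 < r i ^ 2 / ϱ i ^ 2 :=
    fun i => div_pos (pow_pos (hr i) 2) (pow_pos (hϱ i) 2)
  have hcc := closingDifferential_comp_closingAdjoint (r := r) (ϱ := ϱ) hy.2.1
  obtain ⟨Z, hdetZ, hZ⟩ := exists_det_eq_det_metricAdjoint_comp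
    ((ballPolMetric d ϱ).restrict (tangentSpaceAt (unitBall d ×ˢ PolX d r) (w, y)))
    (restrict_nondegenerate (ballPolMetric d ϱ) (ballPolMetric_pos d ϱ hϱ) _) (armMetric d ϱ)
    (differentialAlong opening (unitBall d ×ˢ PolX d r) (w, y)) (tangentEquiv hn hr hw hy)
  have hgram := det_gram_of_ker (gU := innerₗ (Vec d)) (cs := closingAdjoint r ϱ y)
    (A := LinearMap.pi fun i => centerField w (y i)) (X := conformalFactorSq w y) (Z := Z)
    (nondegenerate_innerₗ _) (restrict_nondegenerate _ (armTangentMetric_pos hϱ) _)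
    armTangentMetric_comm (armTangentMetric_closingAdjoint fun i => (hϱ i).ne')
    (hcc ▸ projOp_injective hn hy.2 hc)
    (fun p q => (hZ p q).trans (armMetric_differentialAlong_opening hn hr hw hy p q))
  rw [hcc, closingDifferential_comp_centerField hy.1, LinearMap.det_smul, det_projOp, det_projOp,
    finrank_euclideanSpace_fin, conformalFactorSq,
    det_pi_smul fun i => finrank_orthogonal_of_norm_eq_one (hy.2.1 i)] at hgram
  rw [← hgram, mul_div_cancel_right₀ _ (det_projSum_pos hn hy.2 hc).ne', ← hdetZ]
  rfl

theorem Jop_eq (hn : 3 ≤ n) (hr : ∀ i, 0 < r i) (hϱ : ∀ i, 0 < ϱ i) (hw : w ∈ unitBall d)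
    (hy : y ∈ PolX d r) :
    Jop r ϱ hϱ w y = (2 / (1 - ‖w‖ ^ 2)) ^ d *
      ((projSum r y).det / √(projSum (fun i => r i ^ 2 / ϱ i ^ 2) y).det) *
      (∏ i, (1 - ‖w‖ ^ 2) / ‖w + y i‖ ^ 2) ^ (d - 1) := by
  have hball := one_sub_norm_sq_pos hw
  have hdet := det_projSum_pos hn hy.2 hr
  rw [Jop_eq_sqrt hn hr hϱ hw hy]
  simp only [add_comm (y _) w]
  rw [Finset.prod_pow, ← pow_mul, mul_comm 2 (d - 1), pow_mul, ← mul_pow,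
    Real.sqrt_div (sq_nonneg _), Real.sqrt_sq (by positivity)]
  ring

theorem Jop_ne_zero (hn : 3 ≤ n) (hr : ∀ i, 0 < r i) (hϱ : ∀ i, 0 < ϱ i) (hw : w ∈ unitBall d)
    (hy : y ∈ PolX d r) : Jop r ϱ hϱ w y ≠ 0 := by
  have hball := one_sub_norm_sq_pos hw
  have hdet := det_projSum_pos hn hy.2 hr
  have hdet' := det_projSum_pos hn hy.2 fun i => div_pos (pow_pos (hr i) 2) (pow_pos (hϱ i) 2)
  have hprod : 0 < ∏ i, (1 - ‖w‖ ^ 2) / ‖w + y i‖ ^ 2 := Finset.prod_pos fun i _ =>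
    div_pos hball (add_comm (y i) w ▸ norm_add_sq_pos hw (hy.2.1 i))
  rw [Jop_eq hn hr hϱ hw hy]
  positivity

end Jacobian

/-! ### Functions computable on the real random access machine -/

namespace RealRAM

theorem run_loop_induction {P : Prog} {i : ℕ} {s : State} (Inv : ℕ → State → Prop)
    (zero : Inv 0 s.tick)
    (succ : ∀ m < s.idx i, ∀ t, Inv m t → Inv (m + 1) (run P t.tick)) :
    Inv (s.idx i) (run (.loop i P) s) := by
  have hInv : ∀ m ≤ s.idx i, Inv m ((fun t => run P t.tick)^[m] s.tick) := by
    intro m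
    induction m with
    | zero => exact fun _ => zero
    | succ m ih =>
      intro hm
      rw [Function.iterate_succ_apply']
      exact succ m hm _ (ih (Nat.le_of_succ_le hm))
  exact hInv _ le_rfl

/-- `inst a b c` is the instruction `x_a := f x_b x_c`. -/
def IsBinaryInstruction (inst : ℕ → ℕ → ℕ → Prog) (f : ℝ → ℝ → ℝ) : Prop :=
  ∀ a b c s, run (inst a b c) s = s.setReal a (f (s.real b) (s.real c))

section Computes

variable {Ctx : Type*} {Pre : Ctx → (ℕ → ℕ) → (ℕ → ℝ) → Prop} {T S : Ctx → ℕ} {F G : Ctx → ℝ}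

/-- `F` can be computed in time `O(T + 1)` and with the first `S` memory cells, whenever the index
registers and the memory satisfy `Pre`. The result goes to a real register `x_k` of one's choice;
`Pre` and the real registers below `x_k` are preserved, which makes such computations composable. -/
def Computes (Pre : Ctx → (ℕ → ℕ) → (ℕ → ℝ) → Prop) (T S : Ctx → ℕ) (F : Ctx → ℝ) : Prop :=
  ∀ k, ∃ (P : Prog) (C : ℕ), ∀ c s, Pre c s.idx s.mem →
    Pre c (run P s).idx (run P s).mem ∧ (run P s).real k = F c ∧
    (∀ j < k, (run P s).real j = s.real j) ∧ (run P s).steps ≤ s.steps + C * (T c + 1) ∧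
    (run P s).space ≤ max s.space (S c)

namespace Computes

theorem congr (h : Computes Pre T S F) (hFG : ∀ c, G c = F c) : Computes Pre T S G := by
  rwa [funext hFG]

theorem const (q : ℚ) : Computes Pre T S fun _ => (q : ℝ) := by
  refine fun k => ⟨.const k q, 1, fun c s h => ⟨h, Function.update_self .., fun j hj => ?_, ?_,
    le_max_left _ _⟩⟩
  · exact Function.update_of_ne hj.ne _ _
  · simp only [run, State.setReal]
    omega

theorem binary {f : ℝ → ℝ → ℝ} {inst : ℕ → ℕ → ℕ → Prog} (hinst : IsBinaryInstruction inst f)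
    (hF : Computes Pre T S F) (hG : Computes Pre T S G) :
    Computes Pre T S fun c => f (F c) (G c) := by
  intro k
  obtain ⟨P, C, hP⟩ := hF k
  obtain ⟨Q, D, hQ⟩ := hG (k + 1)
  refine ⟨.seq P (.seq Q (inst k k (k + 1))), C + D + 1, fun c s h => ?_⟩
  obtain ⟨hPpre, hPreal, hPframe, hPsteps, hPspace⟩ := hP c s h
  obtain ⟨hQpre, hQreal, hQframe, hQsteps, hQspace⟩ := hQ c _ hPpre
  simp only [run, hinst k k (k + 1), State.setReal]
  refine ⟨hQpre, ?_, fun j hj => ?_, ?_, hQspace.trans (max_le hPspace (le_max_right _ _))⟩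
  · rw [Function.update_self, hQreal, hQframe k k.lt_succ_self, hPreal]
  · rw [Function.update_of_ne hj.ne, hQframe j (hj.trans k.lt_succ_self), hPframe j hj]
  · rw [add_mul, add_mul]
    omega

theorem add (hF : Computes Pre T S F) (hG : Computes Pre T S G) :
    Computes Pre T S fun c => F c + G c :=
  binary (inst := .add) (fun _ _ _ _ => rfl) hF hG

theorem sub (hF : Computes Pre T S F) (hG : Computes Pre T S G) :
    Computes Pre T S fun c => F c - G c :=
  binary (inst := .sub) (fun _ _ _ _ => rfl) hF hG

theorem mul (hF : Computes Pre T S F) (hG : Computes Pre T S G) :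
    Computes Pre T S fun c => F c * G c :=
  binary (inst := .mul) (fun _ _ _ _ => rfl) hF hG

theorem div (hF : Computes Pre T S F) (hG : Computes Pre T S G) :
    Computes Pre T S fun c => F c / G c :=
  binary (inst := .div) (fun _ _ _ _ => rfl) hF hG

theorem sqrt (hF : Computes Pre T S F) : Computes Pre T S fun c => √(F c) :=
  binary (inst := fun a b _ => .sqrt a b) (f := fun x _ => √x) (fun _ _ _ _ => rfl) hF hF

theorem pow (hF : Computes Pre T S F) (m : ℕ) : Computes Pre T S fun c => F c ^ m := by
  induction m with
  | zero => exact (const 1).congr fun _ => by simp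
  | succ m ih => exact (ih.mul hF).congr fun c => pow_succ _ _

theorem finsetSum {ι : Type*} {s : Finset ι} {f : ι → Ctx → ℝ}
    (hf : ∀ i ∈ s, Computes Pre T S (f i)) : Computes Pre T S fun c => ∑ i ∈ s, f i c := by
  classical
  induction s using Finset.induction_on with
  | empty => exact (const 0).congr fun _ => by simp
  | insert i s hi ih =>
    obtain ⟨hfi, hfs⟩ := Finset.forall_mem_insert .. |>.1 hf
    exact (hfi.add (ih hfs)).congr fun c => Finset.sum_insert hi

theorem finsetProd {ι : Type*} {s : Finset ι} {f : ι → Ctx → ℝ}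
    (hf : ∀ i ∈ s, Computes Pre T S (f i)) : Computes Pre T S fun c => ∏ i ∈ s, f i c := by
  classical
  induction s using Finset.induction_on with
  | empty => exact (const 1).congr fun _ => by simp
  | insert i s hi ih =>
    obtain ⟨hfi, hfs⟩ := Finset.forall_mem_insert .. |>.1 hf
    exact (hfi.mul (ih hfs)).congr fun c => Finset.prod_insert hi

theorem norm_sq {ι : Type*} [Fintype ι] {v : Ctx → EuclideanSpace ℝ ι}
    (hv : ∀ k, Computes Pre T S fun c => v c k) : Computes Pre T S fun c => ‖v c‖ ^ 2 :=
  (finsetSum fun k _ => (hv k).pow 2).congr fun c => EuclideanSpace.real_norm_sq_eq (v c)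

theorem det {ι : Type*} [Fintype ι] [DecidableEq ι] {M : Ctx → Matrix ι ι ℝ}
    (hM : ∀ a b, Computes Pre T S fun c => M c a b) : Computes Pre T S fun c => (M c).det :=
  (finsetSum (s := Finset.univ) fun (σ : Equiv.Perm ι) _ =>
    (const (Equiv.Perm.sign σ : ℤ)).mul (finsetProd (s := Finset.univ) fun i _ => hM (σ i) i)).congr
    fun c => by simp [Matrix.det_apply']

theorem load_const (a : ℕ)
    (hidx : ∀ c idx mem v, Pre c idx mem → Pre c (Function.update idx 2 v) mem)
    (hF : ∀ c idx mem, Pre c idx mem → mem a = F c ∧ a < S c) : Computes Pre T S F := by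
  refine fun k => ⟨.seq (.idxConst 2 a) (.load k 2), 2, fun c s h => ?_⟩
  obtain ⟨hmem, hlt⟩ := hF c _ _ h
  simp only [run, State.setIdx, State.setReal, State.touch, Function.update_self]
  exact ⟨hidx c _ _ _ h, hmem, fun j hj => Function.update_of_ne hj.ne _ _, by omega,
    max_le_max le_rfl hlt⟩

theorem load_idx_add (o : ℕ)
    (hidx : ∀ c idx mem v, Pre c idx mem → Pre c (Function.update idx 2 v) mem)
    (hF : ∀ c idx mem, Pre c idx mem → mem (idx 1 + o) = F c ∧ idx 1 + o < S c) :
    Computes Pre T S F := by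
  refine fun k => ⟨.seq (.idxConst 2 o) (.seq (.idxAdd 2 1 2) (.load k 2)), 3, fun c s h => ?_⟩
  obtain ⟨hmem, hlt⟩ := hF c _ _ h
  simp only [run, State.setIdx, State.setReal, State.touch, Function.update_self,
    Function.update_idem, Function.update_of_ne (show (1 : ℕ) ≠ 2 by norm_num)]
  exact ⟨hidx c _ _ _ h, hmem, fun j hj => Function.update_of_ne hj.ne _ _, by omega,
    max_le_max le_rfl hlt⟩

end Computes

end Computes

end RealRAM

/-! ### The Jacobian in linear time -/

section LinearTime

open RealRAM

variable {d : ℕ}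

/-- The input `(n, r, ϱ, w, y)` of the computation of the Jacobian. -/
structure PolygonInput (d : ℕ) : Type where
  n : ℕ
  r : Fin n → ℝ
  ϱ : Fin n → ℝ
  w : Vec d
  y : Fin n → Vec d

/-- The number of memory cells occupied by the input. -/
def PolygonInput.size (I : PolygonInput d) : ℕ := d + I.n * (d + 2)

/-- The registers and the memory hold the input, in the format of `HoldsInput`. -/
structure InputPre (I : PolygonInput d) (idx : ℕ → ℕ) (mem : ℕ → ℝ) : Prop where
  size : idx 0 = I.n
  mem_w : ∀ k : Fin d, mem k = I.w k
  mem_r : ∀ i : Fin I.n, mem (d + i * (d + 2)) = I.r i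
  mem_ϱ : ∀ i : Fin I.n, mem (d + i * (d + 2) + 1) = I.ϱ i
  mem_y : ∀ (i : Fin I.n) (k : Fin d), mem (d + i * (d + 2) + 2 + k) = I.y i k

/-- An input with a distinguished edge. -/
abbrev PolygonEdge (d : ℕ) : Type := (I : PolygonInput d) × Fin I.n

/-- The memory holds the input, and the index register `p₁` points to the record of an edge. -/
def EdgePre (c : PolygonEdge d) (idx : ℕ → ℕ) (mem : ℕ → ℝ) : Prop :=
  InputPre c.1 idx mem ∧ idx 1 = d + c.2 * (d + 2)

/-- Functions of the whole input that are computable in linear time. -/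
abbrev LinearTime (F : PolygonInput d → ℝ) : Prop :=
  Computes InputPre PolygonInput.n PolygonInput.size F

/-- Functions of one edge and the centre that are computable in constant time. -/
abbrev ConstantTime (F : PolygonEdge d → ℝ) : Prop :=
  Computes EdgePre (fun _ => 0) (fun c => c.1.size) F

theorem InputPre.update {I : PolygonInput d} {idx : ℕ → ℕ} {mem : ℕ → ℝ}
    (h : InputPre I idx mem) {j : ℕ} (hj : j ≠ 0) (v : ℕ) :
    InputPre I (Function.update idx j v) mem :=
  ⟨by rw [Function.update_of_ne hj.symm, h.size], h.mem_w, h.mem_r, h.mem_ϱ, h.mem_y⟩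

theorem EdgePre.update_two (c : PolygonEdge d) (idx : ℕ → ℕ) (mem : ℕ → ℝ) (v : ℕ)
    (h : EdgePre c idx mem) : EdgePre c (Function.update idx 2 v) mem :=
  ⟨h.1.update two_ne_zero v, by rw [Function.update_of_ne (by norm_num), h.2]⟩

theorem val_lt_size (I : PolygonInput d) (k : Fin d) : (k : ℕ) < I.size :=
  k.2.trans_le (Nat.le_add_right _ _)

theorem edge_record_le_size (c : PolygonEdge d) : d + c.2 * (d + 2) + (d + 2) ≤ c.1.size := by
  rw [PolygonInput.size, add_assoc, ← Nat.succ_mul]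
  exact Nat.add_le_add_left (Nat.mul_le_mul_right _ c.2.2) d

theorem linearTime_w (k : Fin d) : LinearTime fun I : PolygonInput d => I.w k :=
  Computes.load_const k (fun _ _ _ v h => h.update two_ne_zero v) fun I _ _ h =>
    ⟨h.mem_w k, val_lt_size I k⟩

theorem constantTime_w (k : Fin d) : ConstantTime fun c : PolygonEdge d => c.1.w k :=
  Computes.load_const k EdgePre.update_two fun c _ _ h => ⟨h.1.mem_w k, val_lt_size c.1 k⟩

theorem constantTime_r : ConstantTime fun c : PolygonEdge d => c.1.r c.2 :=
  Computes.load_idx_add 0 EdgePre.update_two fun c _ _ h =>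
    ⟨by rw [h.2, add_zero, h.1.mem_r], by have := edge_record_le_size c; rw [h.2]; omega⟩

theorem constantTime_ϱ : ConstantTime fun c : PolygonEdge d => c.1.ϱ c.2 :=
  Computes.load_idx_add 1 EdgePre.update_two fun c _ _ h =>
    ⟨by rw [h.2, h.1.mem_ϱ], by have := edge_record_le_size c; rw [h.2]; omega⟩

theorem constantTime_y (k : Fin d) : ConstantTime fun c : PolygonEdge d => c.1.y c.2 k :=
  Computes.load_idx_add (2 + k) EdgePre.update_two fun c _ _ h =>
    ⟨by rw [h.2, ← add_assoc, h.1.mem_y], by have := edge_record_le_size c; rw [h.2]; omega⟩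

/-- The body of the loop over the edges: from the value of the current edge, computed by `P` into
`x_{k+1}`, update the accumulator `x_k`, and advance the pointer `p₁` by the record length. -/
def foldStep (d : ℕ) (inst : ℕ → ℕ → ℕ → Prog) (k : ℕ) (P : Prog) : Prog :=
  .seq P (.seq (inst k k (k + 1)) (.seq (.idxConst 3 (d + 2)) (.idxAdd 1 1 3)))

/-- The invariant of the loop over the edges, started in the state `s` with accumulator `x_k`:
after `m` iterations of cost at most `B`, the accumulator holds `a` and `p₁` points to the `m`-th
record. -/
structure FoldInvariant (I : PolygonInput d) (s : State) (k B : ℕ) (a : ℝ) (m : ℕ) (t : State) :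
    Prop where
  input : InputPre I t.idx t.mem
  pointer : t.idx 1 = d + m * (d + 2)
  accumulator : t.real k = a
  frame : ∀ j < k, t.real j = s.real j
  steps : t.steps ≤ s.steps + 3 + m * B
  space : t.space ≤ max s.space I.size

theorem FoldInvariant.start {I : PolygonInput d} {s : State} (h : InputPre I s.idx s.mem)
    (k B : ℕ) (q : ℚ) :
    FoldInvariant I s k B q 0 (run (.idxConst 1 d) (run (.const k q) s)).tick where
  input := h.update one_ne_zero d
  pointer := by simp [run, State.setIdx, State.setReal, State.tick]
  accumulator := by simp [run, State.setIdx, State.setReal, State.tick]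
  frame j hj := Function.update_of_ne hj.ne _ _
  steps := by simp [run, State.setIdx, State.setReal, State.tick]
  space := le_max_left _ _

theorem FoldInvariant.step {f : ℝ → ℝ → ℝ} {inst : ℕ → ℕ → ℕ → Prog} {F : PolygonEdge d → ℝ}
    {k C : ℕ} {P : Prog} (hinst : IsBinaryInstruction inst f)
    (hP : ∀ c s, EdgePre c s.idx s.mem →
      EdgePre c (run P s).idx (run P s).mem ∧ (run P s).real (k + 1) = F c ∧
      (∀ j < k + 1, (run P s).real j = s.real j) ∧ (run P s).steps ≤ s.steps + C * (0 + 1) ∧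
      (run P s).space ≤ max s.space c.1.size)
    {I : PolygonInput d} {s t : State} {a : ℝ} (i : Fin I.n)
    (ht : FoldInvariant I s k (C + 4) a i t) :
    FoldInvariant I s k (C + 4) (f a (F ⟨I, i⟩)) (i + 1)
      (run (foldStep d inst k P) t.tick) := by
  obtain ⟨hpre, hreal, hframe, hsteps, hspace⟩ := hP ⟨I, i⟩ t.tick ⟨ht.input, ht.pointer⟩
  simp only [foldStep, run, hinst k k (k + 1), State.setReal, State.setIdx]
  refine ⟨(hpre.1.update three_ne_zero _).update one_ne_zero _, ?_, ?_, fun j hj => ?_, ?_,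
    hspace.trans (max_le ht.space (le_max_right _ _))⟩
  · simp only [Function.update_self, Function.update_of_ne (show (1 : ℕ) ≠ 3 by norm_num), hpre.2]
    ring
  · dsimp only
    rw [Function.update_self, hreal, hframe k k.lt_succ_self]
    exact congrArg (f · (F ⟨I, i⟩)) ht.accumulator
  · dsimp only
    rw [Function.update_of_ne hj.ne, hframe j (hj.trans k.lt_succ_self)]
    exact ht.frame j hj
  · have htick : t.tick.steps = t.steps + 1 := rfl
    have hprev := ht.steps
    dsimp only
    rw [add_one_mul (i : ℕ)]
    omega

theorem LinearTime.foldl_edges {F : PolygonEdge d → ℝ} {f : ℝ → ℝ → ℝ}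
    {inst : ℕ → ℕ → ℕ → Prog} (hinst : IsBinaryInstruction inst f) (hF : ConstantTime F) (q : ℚ) :
    LinearTime fun I => (List.ofFn fun i => F ⟨I, i⟩).foldl f q := by
  intro k
  obtain ⟨P, C, hP⟩ := hF (k + 1)
  refine ⟨.seq (.const k q) (.seq (.idxConst 1 d) (.loop 0 (foldStep d inst k P))), C + 4,
    fun I s h => ?_⟩
  let partialFold (m : ℕ) : ℝ := ((List.ofFn fun i => F ⟨I, i⟩).take m).foldl f q
  have hpartialFold (m : ℕ) (hm : m < I.n) :
      partialFold (m + 1) = f (partialFold m) (F ⟨I, ⟨m, hm⟩⟩) := by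
    simp only [partialFold]
    rw [List.take_succ_eq_append_getElem (hm.trans_eq List.length_ofFn.symm), List.foldl_append]
    simp
  have hn : (run (.idxConst 1 d) (run (.const k q) s)).idx 0 = I.n := by
    simp [run, State.setIdx, State.setReal, h.size]
  have hloop := run_loop_induction (P := foldStep d inst k P) (i := 0)
    (fun m => FoldInvariant I s k (C + 4) (partialFold m) m)
    (FoldInvariant.start h k (C + 4) q) fun m hm t ht =>
      hpartialFold m (hn ▸ hm) ▸ FoldInvariant.step hinst hP ⟨m, hn ▸ hm⟩ ht
  rw [hn] at hloop
  refine ⟨hloop.input, hloop.accumulator.trans ?_, hloop.frame, hloop.steps.trans ?_, hloop.space⟩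
  · simp [partialFold, List.take_of_length_le]
  · rw [mul_add_one, mul_comm I.n]
    omega

theorem LinearTime.sum_edges {F : PolygonEdge d → ℝ} (hF : ConstantTime F) :
    LinearTime fun I => ∑ i, F ⟨I, i⟩ :=
  (foldl_edges (f := (· + ·)) (inst := .add) (fun _ _ _ _ => rfl) hF 0).congr fun I => by
    rw [← List.sum_ofFn, List.sum_eq_foldl, Rat.cast_zero]

theorem LinearTime.prod_edges {F : PolygonEdge d → ℝ} (hF : ConstantTime F) :
    LinearTime fun I => ∏ i, F ⟨I, i⟩ :=
  (foldl_edges (f := (· * ·)) (inst := .mul) (fun _ _ _ _ => rfl) hF 1).congr fun I => by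
    rw [← List.prod_ofFn, List.prod_eq_foldl, Rat.cast_one]

theorem linearTime_one_sub_norm_sq : LinearTime fun I : PolygonInput d => 1 - ‖I.w‖ ^ 2 :=
  ((Computes.const 1).sub (Computes.norm_sq linearTime_w)).congr fun I => by rw [Rat.cast_one]

theorem constantTime_conformalFactor :
    ConstantTime fun c : PolygonEdge d => (1 - ‖c.1.w‖ ^ 2) / ‖c.1.w + c.1.y c.2‖ ^ 2 :=
  (((Computes.const 1).sub (Computes.norm_sq constantTime_w)).div
    (Computes.norm_sq fun k => (constantTime_w k).add (constantTime_y k))).congr fun c => by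
      rw [Rat.cast_one]

theorem projSum_apply {n : ℕ} (c : Fin n → ℝ) (y : Fin n → Vec d) (a b : Fin d) :
    projSum c y a b = ∑ i, c i * ((if a = b then 1 else 0) - y i a * y i b) := by
  simp [projSum, Matrix.sum_apply, Matrix.one_apply]

theorem linearTime_det_projSum {c : PolygonEdge d → ℝ} (hc : ConstantTime c) :
    LinearTime fun I => (projSum (fun i => c ⟨I, i⟩) I.y).det := by
  refine Computes.det fun a b => ?_
  refine (LinearTime.sum_edges (hc.mul ((Computes.const (if a = b then 1 else 0)).sub
    ((constantTime_y a).mul (constantTime_y b))))).congr fun I => ?_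
  simp only [projSum_apply, apply_ite Rat.cast, Rat.cast_one, Rat.cast_zero]

theorem linearTime_jacobian : LinearTime fun I : PolygonInput d =>
    (2 / (1 - ‖I.w‖ ^ 2)) ^ d *
      ((projSum I.r I.y).det / √(projSum (fun i => I.r i ^ 2 / I.ϱ i ^ 2) I.y).det) *
      (∏ i, (1 - ‖I.w‖ ^ 2) / ‖I.w + I.y i‖ ^ 2) ^ (d - 1) := by
  have hconformal := ((Computes.const 2).div (linearTime_one_sub_norm_sq (d := d))).pow d
  have hgram := linearTime_det_projSum (d := d) ((constantTime_r.pow 2).div (constantTime_ϱ.pow 2))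
  have hdet := (linearTime_det_projSum constantTime_r).div hgram.sqrt
  have hprod := (LinearTime.prod_edges (constantTime_conformalFactor (d := d))).pow (d - 1)
  exact ((hconformal.mul hdet).mul hprod).congr fun I => by rw [Rat.cast_ofNat]

theorem LinearTime.exists_prog {F : PolygonInput d → ℝ} (hF : LinearTime F) :
    ∃ (P : Prog) (C : ℕ), ∀ (I : PolygonInput d) (s : State), 1 ≤ I.n →
      HoldsInput I.r I.ϱ I.w I.y s →
        (run P s).real 0 = F I ∧ (run P s).steps ≤ C * I.n ∧ (run P s).space ≤ C * I.n := by
  obtain ⟨P, C, hP⟩ := hF 0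
  refine ⟨P, 2 * C + (2 * d + 2), fun I s hn hs => ?_⟩
  obtain ⟨-, hreal, -, hsteps, hspace⟩ := hP I s ⟨hs.size, hs.mem_w, hs.mem_r, hs.mem_ϱ, hs.mem_y⟩
  rw [hs.steps, zero_add] at hsteps
  rw [hs.space, Nat.zero_max, PolygonInput.size] at hspace
  exact ⟨hreal, hsteps.trans (by nlinarith), hspace.trans (by nlinarith)⟩

end LinearTime

end ConformalPolygon

end

theorem theorem3p1 (d : ℕ) (hd : 2 ≤ d) :
    -- the formula for the Jacobian, and the diffeomorphism
    (∀ (n : ℕ), 3 ≤ n → ∀ (r ϱ : Fin n → ℝ), (∀ i, 0 < r i) → ∀ (hϱ : ∀ i, 0 < ϱ i),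
      (∀ j, r j < (1 / 2) * ∑ i, r i) →
        (∀ w ∈ ConformalPolygon.unitBall d, ∀ y ∈ ConformalPolygon.PolX d r,
          ConformalPolygon.Jop r ϱ hϱ w y =
            (2 / (1 - ‖w‖ ^ 2)) ^ d *
              ((ConformalPolygon.projSum r y).det /
                Real.sqrt (ConformalPolygon.projSum (fun i => r i ^ 2 / ϱ i ^ 2) y).det) *
              (∏ i, (1 - ‖w‖ ^ 2) / ‖w + y i‖ ^ 2) ^ (d - 1) ∧
          ConformalPolygon.Jop r ϱ hϱ w y ≠ 0) ∧
        ConformalPolygon.IsSmoothSubmanifold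
          (ConformalPolygon.unitBall d ×ˢ ConformalPolygon.PolX d r) (n * (d - 1)) ∧
        ConformalPolygon.IsSmoothSubmanifold (ConformalPolygon.ArmX d n) (n * (d - 1)) ∧
        (∀ x ∈ ConformalPolygon.ArmX d n,
          ∃! w, ConformalPolygon.IsConformalBarycenter r x w) ∧
        ConformalPolygon.IsDiffeomorphismWithInverse
          ConformalPolygon.opening (ConformalPolygon.closureMap r)
          (ConformalPolygon.unitBall d ×ˢ ConformalPolygon.PolX d r)
          (ConformalPolygon.ArmX d n)) ∧
    -- linear time and memory, by one program that depends only on `d`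
    (∃ (P : ConformalPolygon.RealRAM.Prog) (C : ℕ), ∀ (n : ℕ), 3 ≤ n →
      ∀ (r ϱ : Fin n → ℝ), (∀ i, 0 < r i) → ∀ (hϱ : ∀ i, 0 < ϱ i),
      (∀ j, r j < (1 / 2) * ∑ i, r i) →
        ∀ w ∈ ConformalPolygon.unitBall d, ∀ y ∈ ConformalPolygon.PolX d r,
          ∀ s : ConformalPolygon.RealRAM.State, ConformalPolygon.HoldsInput r ϱ w y s →
            (ConformalPolygon.RealRAM.run P s).real 0 = ConformalPolygon.Jop r ϱ hϱ w y ∧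
            (ConformalPolygon.RealRAM.run P s).steps ≤ C * n ∧
            (ConformalPolygon.RealRAM.run P s).space ≤ C * n) := by
  refine ⟨fun n hn r ϱ hr hϱ hr2 =>
    ⟨fun w hw y hy => ⟨ConformalPolygon.Jop_eq hn hr hϱ hw hy,
      ConformalPolygon.Jop_ne_zero hn hr hϱ hw hy⟩,
    ConformalPolygon.isSmoothSubmanifold_ball_prod_PolX (by omega) hn hr,
    ConformalPolygon.isSmoothSubmanifold_ArmX (by omega),
    fun x hx => ConformalPolygon.existsUnique_isConformalBarycenter hn hr hr2 hx,
    ConformalPolygon.isDiffeomorphism_opening hn hr hr2⟩, ?_⟩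
  obtain ⟨P, C, hP⟩ := (ConformalPolygon.linearTime_jacobian (d := d)).exists_prog
  refine ⟨P, C, fun n hn r ϱ hr hϱ _ w hw y hy s hs => ?_⟩
  rw [ConformalPolygon.Jop_eq hn hr hϱ hw hy]
  exact hP ⟨n, r, ϱ, w, y⟩ s (Nat.one_le_of_lt hn) hs
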